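/- All knots are tame simple closed curves in $\mathbb{R}^3$, and a knot type $[K]$ is an ambient isotopy class of such curves; its elements are called the conformations of $[K]$. For a conformation $K$ and a unit vector $p\in S^2$, let $\mathrm{br}(K,p)$ be the number of local maxima on $K$ of the height function $y\mapsto\langle p,y\rangle$, where a maximum attained along an interval of constant height (or along all of $K$) is counted once. The superbridge index is $$\mathrm{sbr}[K]=\min_{K\in[K]}\ \max_{p\in S^2}\ \mathrm{br}(K,p).$$ A spherical stick diagram is a closed curve on the unit sphere $S^2\subset\mathbb{R}^3$ made of finitely many great circle arcs, whose only self-intersections are finitely many double points in the interiors of arcs, together with a choice of overstrand and understrand at each double point. It represents $[K]$ if some conformation of $[K]$ that misses the origin projects radially onto the curve so that at each double point the overstrand is farther from the origin than the understrand. The spherical stick index $\mathrm{sps}[K]$ is the minimum number of great circle arcs in a spherical stick diagram that represents $[K]$. (An entire great circle is admitted as an arc; this affects only the unknot, for which it gives $\mathrm{sps}=1$.) **Theorem.** For every knot type $[K]$, $$\tfrac{2}{3}\,\mathrm{sbr}[K]+\tfrac{1}{3}\le \mathrm{sps}[K].$$ -/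

import Mathlib

open Set
open scoped ENNReal

namespace SphericalStick

/-- Euclidean three-space. -/
abbrev E3 : Type := EuclideanSpace ℝ (Fin 3)

/-! ### Knots and knot types -/

/-- Ambient isotopy of subsets of three-space: there is a continuous family of homeomorphisms of the
whole space, starting at the identity, whose final member carries `A` onto `B`. -/
def AmbientIsotopic (A B : Set E3) : Prop :=
  ∃ H : unitInterval → (E3 ≃ₜ E3),
    Continuous (fun q : unitInterval × E3 => H q.1 q.2) ∧
    (∀ x, H 0 x = x) ∧ H 1 '' A = B

theorem AmbientIsotopic.refl (A : Set E3) : AmbientIsotopic A A :=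
  ⟨fun _ => Homeomorph.refl E3, continuous_snd, fun _ => rfl, by simp⟩

theorem AmbientIsotopic.symm {A B : Set E3} (h : AmbientIsotopic A B) : AmbientIsotopic B A := by
  obtain ⟨H, hc, h0, h1⟩ := h
  refine ⟨fun t => (H 1).symm.trans (H (unitInterval.symm t)), ?_, ?_, ?_⟩
  · exact hc.comp (((unitInterval.continuous_symm).comp continuous_fst).prodMk
      ((H 1).symm.continuous.comp continuous_snd))
  · intro x
    simp
  · rw [← h1, ← image_comp]
    ext x
    simp [h0]

theorem AmbientIsotopic.trans {A B C : Set E3} (h : AmbientIsotopic A B)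
    (h' : AmbientIsotopic B C) : AmbientIsotopic A C := by
  obtain ⟨H, hc, h0, h1⟩ := h
  obtain ⟨G, gc, g0, g1⟩ := h'
  refine ⟨fun t => (H t).trans (G t), ?_, ?_, ?_⟩
  · exact gc.comp (continuous_fst.prodMk hc)
  · intro x
    simp [h0, g0]
  · rw [← g1, ← h1, ← image_comp]
    rfl

/-- A closed polygonal curve in space: the union of the edges joining cyclically consecutive
vertices. -/
def IsClosedPolygon (P : Set E3) : Prop :=
  ∃ (m : ℕ) (_ : 0 < m) (v : ZMod m → E3), P = ⋃ i : ZMod m, segment ℝ (v i) (v (i + 1))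

/-- A (tame, unoriented) knot in three-space: a simple closed curve that is ambient isotopic to a
polygon. -/
structure Knot where
  carrier : Set E3
  simple_closed : ∃ f : Circle → E3, Continuous f ∧ Function.Injective f ∧ range f = carrier
  tame : ∃ P : Set E3, IsClosedPolygon P ∧ AmbientIsotopic carrier P

/-- Two knots have the same type when they are ambient isotopic. -/
instance knotSetoid : Setoid Knot where
  r K L := AmbientIsotopic K.carrier L.carrier
  iseqv :=
    ⟨fun K => AmbientIsotopic.refl K.carrier, fun h => h.symm, fun h h' => h.trans h'⟩

/-- A knot type is an ambient isotopy class of knots. -/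
def KnotType : Type := Quotient knotSetoid

/-- The type of a knot; `K` is a conformation of `κ` when `knotType K = κ`. -/
def knotType (K : Knot) : KnotType := Quotient.mk knotSetoid K

/-! ### Superbridge index -/

/-- The local maxima of the height function `y ↦ ⟪p, y⟫` on `K`. A maximum attained along an
interval of constant height is a single maximum: a maximum is a connected component `C` of a level
set of the height function on `K` such that no point of `K` near `C` is higher. -/
def localMaxima (K : Set E3) (p : E3) : Set (Set E3) :=
  {C | ∃ x ∈ K, C = connectedComponentIn {y | y ∈ K ∧ inner ℝ p y = inner ℝ p x} x ∧
    ∃ U : Set E3, IsOpen U ∧ C ⊆ U ∧ ∀ y ∈ U ∩ K, inner ℝ p y ≤ inner ℝ p x}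

/-- The number of local maxima of `K` in the direction `p`. -/
noncomputable def br (K : Set E3) (p : E3) : ℕ∞ := (localMaxima K p).encard

/-- The superbridge index: the minimum over all conformations of the knot type of the maximum over
all directions of the number of local maxima. -/
noncomputable def superbridgeIndex (κ : KnotType) : ℕ∞ :=
  ⨅ (K : Knot) (_ : knotType K = κ), ⨆ p ∈ Metric.sphere (0 : E3) 1, br K.carrier p

/-! ### Spherical stick diagrams -/

/-- A closed curve on the unit sphere made of `n` great circle arcs. The arc number `i` starts at
the point `base i` with unit velocity `dir i` and has length `len i`; it ends where the arc number
`i + 1` (modulo `n`) starts. -/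
structure StickCurve (n : ℕ) where
  n_pos : 0 < n
  base : ZMod n → E3
  dir : ZMod n → E3
  len : ZMod n → ℝ
  norm_base : ∀ i, ‖base i‖ = 1
  norm_dir : ∀ i, ‖dir i‖ = 1
  orthogonal : ∀ i, inner ℝ (base i) (dir i) = 0
  len_pos : ∀ i, 0 < len i
  len_le : ∀ i, len i ≤ 2 * Real.pi
  closed : ∀ i, Real.cos (len i) • base i + Real.sin (len i) • dir i = base (i + 1)

namespace StickCurve

variable {n : ℕ}

/-- The arc number `i`, parametrized proportionally to arc length by `[0, 1]`. -/
noncomputable def arc (γ : StickCurve n) (i : ZMod n) (t : ℝ) : E3 :=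
  Real.cos (t * γ.len i) • γ.base i + Real.sin (t * γ.len i) • γ.dir i

/-- The whole closed curve, as a function on the line with period `n`: the arc number `i` is
run through on `[i, i + 1]`. -/
noncomputable def curve (γ : StickCurve n) (x : ℝ) : E3 :=
  γ.arc (⌊x⌋ : ZMod n) (Int.fract x)

/-- Two different parameters (in the fundamental period) of the same point of the curve. -/
def IsCrossing (γ : StickCurve n) (x y : ℝ) : Prop :=
  x ∈ Ico (0 : ℝ) n ∧ y ∈ Ico (0 : ℝ) n ∧ x ≠ y ∧ γ.curve x = γ.curve y

end StickCurve

/-- A spherical stick diagram with `n` great circle arcs: a generic closed curve made of `n` great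
circle arcs (finitely many self-intersections, all of them double points in the interiors of arcs;
these are then transverse, since different great circles are never tangent), together with a choice
of the overstrand at each self-intersection, recorded by the set `upper` of the parameters of the
overstrands. -/
structure StickDiagram (n : ℕ) extends StickCurve n where
  finite_crossings : {q : ℝ × ℝ | toStickCurve.IsCrossing q.1 q.2}.Finite
  crossing_interior : ∀ x y, toStickCurve.IsCrossing x y → Int.fract x ≠ 0
  no_triple : ∀ x y z, toStickCurve.IsCrossing x y → toStickCurve.IsCrossing x z → y = z
  upper : Set ℝ
  upper_iff : ∀ x y, toStickCurve.IsCrossing x y → (x ∈ upper ↔ y ∉ upper)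

/-- A diagram represents a knot type if some conformation of the type projects radially onto it, with
the overstrand farther from the centre of the sphere than the understrand at each crossing. -/
def StickDiagram.Represents {n : ℕ} (D : StickDiagram n) (κ : KnotType) : Prop :=
  ∃ r : ℝ → ℝ, Continuous r ∧ Function.Periodic r n ∧ (∀ x, 0 < r x) ∧
    (∀ x y, D.IsCrossing x y → x ∈ D.upper → r y < r x) ∧
    ∃ K : Knot, knotType K = κ ∧ K.carrier = range (fun x => r x • D.curve x)

/-- The spherical stick index: the minimum number of great circle arcs in a spherical stick diagram
of the knot type. -/
noncomputable def sphericalStickIndex (κ : KnotType) : ℕ∞ :=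
  ⨅ (n : ℕ) (D : StickDiagram n) (_ : D.Represents κ), (n : ℕ∞)

end SphericalStick

/-! The radii of a conformation over a spherical diagram may be changed freely, as long as they stay
continuous and positive and keep the order at each double point: a homeomorphism moving points along
rays does this, and interpolation with the identity makes it an ambient isotopy
(`ambientIsotopic_of_radii`). So it suffices to choose good radii over a diagram with `n` arcs.

The choice is `1 / (1 - e * ⟪u, x⟫)` with `‖u‖ = 1` and `0 ≤ e < 1`: an ellipsoid of revolution with
a focus at the origin. A plane through the origin cuts it in an ellipse with that focus, so each
great circle arc becomes an arc of a convex plane curve whose normal turns by at most `2π`. The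
inverse radius is then perturbed by small polynomials, flat at the ends of the arcs, which produce
the crossings and preserve convexity and the total turning.

When the normal of a convex arc turns by at most `j * π`, a linear height has at most `j + 1`
monotone pieces on it. Hence every arc contributes at most 3 pieces. If `n ≥ 2`, one arc contributes
only 2: it is shorter than a full circle, and with its midpoint at the point of the ellipse nearest
the focus and `e` close to 1, it is nearly an arc of a parabola, whose normal turns half as fast as
the polar angle in total, so by less than `π`. That gives `3n - 1` pieces in all.

Two or more local maxima force two pieces each around the closed curve, because the height drops
between neighbours. So every direction has at most `(3n - 1) / 2` maxima
(`superbridgeIndex_le_of_represents`); for `n = 1` three pieces already give the bound 1. -/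

namespace SphericalStick

/-! ### Piecewise monotone functions and zigzags -/

/-- `h` is monotone or antitone on each of `N` consecutive closed intervals covering `[a, b]`. -/
inductive PiecewiseMonotone (h : ℝ → ℝ) (a : ℝ) : ℝ → ℕ → Prop
  | refl : PiecewiseMonotone h a a 0
  | snoc {b c : ℝ} {N : ℕ} : PiecewiseMonotone h a b N → b ≤ c →
      (MonotoneOn h (Icc b c) ∨ AntitoneOn h (Icc b c)) → PiecewiseMonotone h a c (N + 1)

theorem PiecewiseMonotone.le {h : ℝ → ℝ} {a b : ℝ} {N : ℕ} (H : PiecewiseMonotone h a b N) :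
    a ≤ b := by
  induction H with
  | refl => exact le_rfl
  | snoc _ hbc _ ih => exact ih.trans hbc

theorem PiecewiseMonotone.trans {h : ℝ → ℝ} {a b c : ℝ} {N M : ℕ}
    (H : PiecewiseMonotone h a b N) (H' : PiecewiseMonotone h b c M) :
    PiecewiseMonotone h a c (N + M) := by
  induction H' with
  | refl => exact H
  | snoc _ hbc hm ih => exact ih.snoc hbc hm

theorem PiecewiseMonotone.congr {h g : ℝ → ℝ} {a b : ℝ} {N : ℕ}
    (H : PiecewiseMonotone h a b N) (hg : EqOn h g (Icc a b)) : PiecewiseMonotone g a b N := by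
  induction H with
  | refl => exact .refl
  | snoc H hbc hm ih =>
    refine (ih (hg.mono (Icc_subset_Icc_right hbc))).snoc hbc ?_
    have := hg.mono (Icc_subset_Icc_left H.le)
    exact hm.imp (fun h => h.congr this) (fun h => h.congr this)

theorem PiecewiseMonotone.comp_affine {h : ℝ → ℝ} {a b : ℝ} {N : ℕ}
    (H : PiecewiseMonotone h a b N) {k : ℝ} (hk : 0 < k) (x : ℝ) :
    PiecewiseMonotone (fun s => h ((s - x) * k)) (x + a / k) (x + b / k) N := by
  induction H with
  | refl => exact .refl
  | @snoc b c N H hbc hm ih =>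
    refine ih.snoc (by gcongr) ?_
    have maps : MapsTo (fun s => (s - x) * k) (Icc (x + b / k) (x + c / k)) (Icc b c) := by
      rintro s ⟨h1, h2⟩
      constructor
      · rw [← div_le_iff₀ hk]; linarith
      · rw [← le_div_iff₀ hk]; linarith
    have mono : MonotoneOn (fun s => (s - x) * k) (Icc (x + b / k) (x + c / k)) :=
      fun s _ t _ hst => by dsimp only; gcongr
    exact hm.imp (fun h s hs t ht hst => h (maps hs) (maps ht) (mono hs ht hst))
      (fun h s hs t ht hst => h (maps hs) (maps ht) (mono hs ht hst))

/-- `Zigzag h d x y M`: there is an increasing sequence of `M + 1` points from `x` to `y` along which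
`h` alternately increases and decreases strictly; the last step is an increase if `d` is true and a
decrease if `d` is false. -/
inductive Zigzag (h : ℝ → ℝ) : Bool → ℝ → ℝ → ℕ → Prop
  | nil (d : Bool) (x : ℝ) : Zigzag h d x x 0
  | up {x y z : ℝ} {M : ℕ} : Zigzag h false x y M → y < z → h y < h z → Zigzag h true x z (M + 1)
  | down {x y z : ℝ} {M : ℕ} : Zigzag h true x y M → y < z → h z < h y → Zigzag h false x z (M + 1)

/-- Each step of a zigzag costs a new piece. By induction on the pieces: if the last step lies
wholly in the last piece, the step before must start earlier than `b`, since its direction is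
opposite. Its end may then be pulled back to `b` by monotonicity, leaving a zigzag one step shorter
on the remaining pieces. -/
theorem Zigzag.le_pieces {h : ℝ → ℝ} {a b : ℝ} {N : ℕ} (H : PiecewiseMonotone h a b N) :
    ∀ {d : Bool} {x y : ℝ} {M : ℕ}, Zigzag h d x y M → a ≤ x → y ≤ b → M ≤ N := by
  have le {d : Bool} {x y : ℝ} {M : ℕ} (Z : Zigzag h d x y M) : x ≤ y := by
    induction Z with
    | nil => exact le_rfl
    | up _ h _ ih => exact ih.trans h.le
    | down _ h _ ih => exact ih.trans h.le
  induction H with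
  | refl =>
    intro d x y M Z hx hy
    cases Z with
    | nil => exact le_rfl
    | up Z h1 _ => have := le Z; linarith
    | down Z h1 _ => have := le Z; linarith
  | @snoc b c N H hbc hm ih =>
    intro d x y M Z hx hy
    cases Z with
    | nil => exact Nat.zero_le _
    | @up _ y' _ M Z h1 h2 =>
      rcases le_or_gt y' b with hb | hb
      · exact Nat.succ_le_succ (ih Z hx hb)
      have m1 : y' ∈ Icc b c := ⟨hb.le, by linarith⟩
      have m2 : y ∈ Icc b c := ⟨by linarith, hy⟩
      rcases hm with hm | hm
      · cases Z with
        | nil => omega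
        | @down _ y'' _ M Z h3 h4 =>
          have hb' : h b ≤ h y' := hm ⟨le_rfl, hbc⟩ m1 hb.le
          have : y'' < b := by
            by_contra! hc
            have := hm ⟨hc, by linarith [m1.2]⟩ m1 h3.le
            linarith
          exact Nat.succ_le_succ (ih (Z.down this (by linarith)) hx le_rfl)
      · have := hm m1 m2 h1.le
        linarith
    | @down _ y' _ M Z h1 h2 =>
      rcases le_or_gt y' b with hb | hb
      · exact Nat.succ_le_succ (ih Z hx hb)
      have m1 : y' ∈ Icc b c := ⟨hb.le, by linarith⟩
      have m2 : y ∈ Icc b c := ⟨by linarith, hy⟩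
      rcases hm with hm | hm
      · have := hm m1 m2 h1.le
        linarith
      · cases Z with
        | nil => omega
        | @up _ y'' _ M Z h3 h4 =>
          have hb' : h y' ≤ h b := hm ⟨le_rfl, hbc⟩ m1 hb.le
          have : y'' < b := by
            by_contra! hc
            have := hm ⟨hc, by linarith [m1.2]⟩ m1 h3.le
            linarith
          exact Nat.succ_le_succ (ih (Z.up this (by linarith)) hx le_rfl)

/-- A periodic function that drops strictly below both ends between any two cyclically consecutive
members of a family of `m + 2` points has at least `2 * (m + 2)` monotone pieces in a period. -/
theorem two_mul_le_pieces {h : ℝ → ℝ} {L : ℝ} {N m : ℕ} (hper : Function.Periodic h L)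
    (H : PiecewiseMonotone h 0 L N) (s : ℕ → ℝ) (hs0 : 0 ≤ s 0) (hsL : s (m + 1) < L)
    (hs : ∀ j ≤ m, ∃ t, s j < t ∧ t < s (j + 1) ∧ h t < h (s j) ∧ h t < h (s (j + 1)))
    (hw : ∃ t, s (m + 1) < t ∧ t < s 0 + L ∧ h t < h (s (m + 1)) ∧ h t < h (s 0 + L)) :
    2 * (m + 2) ≤ N := by
  have chain {x : ℝ} {M : ℕ} (Z : Zigzag h true x (s 0) M) :
      ∀ j ≤ m + 1, Zigzag h true x (s j) (M + 2 * j) := by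
    intro j
    induction j with
    | zero => exact fun _ => Z
    | succ j ih =>
      intro hj
      obtain ⟨t, h1, h2, h3, h4⟩ := hs j (by omega)
      exact ((ih (by omega)).down h1 h3).up h2 h4
  have h0L : h L = h 0 := by simpa using hper 0
  obtain ⟨t, h1, h2, h3, h4⟩ := hw
  rw [hper] at h4
  -- The gaps between consecutive points give `2 * (m + 1)` steps. The wrap-around gap must supply
  -- two more inside `[0, L]`, although the cut at `0 ≡ L` may fall on either side of its trough;
  -- comparing the value at the cut with `s 0` or with the trough decides at which ends to add them.
  rcases lt_or_ge t L with htL | htL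
  · rcases lt_or_ge (h 0) (h (s 0)) with h5 | h5
    · have h6 : 0 < s 0 := lt_of_le_of_ne hs0 (by rintro h; rw [← h] at h5; exact h5.false)
      have := ((chain ((Zigzag.nil false 0).up h6 h5) (m + 1) le_rfl).down h1 h3).le_pieces H
        le_rfl htL.le
      omega
    · have := (((chain (Zigzag.nil true (s 0)) (m + 1) le_rfl).down h1 h3).up htL
        (by linarith)).le_pieces H hs0 le_rfl
      omega
  · have ht : h (t - L) = h t := hper.sub_eq t
    have Z : Zigzag h true (t - L) (s 0) 1 := (Zigzag.nil false (t - L)).up (by linarith)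
      (by linarith)
    rcases lt_or_ge (h t) (h 0) with h5 | h5
    · have h6 : 0 < t - L := lt_of_le_of_ne (by linarith)
        (by intro h; rw [← ht, ← h] at h5; exact h5.false)
      have := (chain (((Zigzag.nil true 0).down h6 (by linarith)).up (by linarith)
        (by linarith)) (m + 1) le_rfl).le_pieces H le_rfl hsL.le
      omega
    · have := ((chain Z (m + 1) le_rfl).down hsL (by linarith)).le_pieces H (by linarith) le_rfl
      omega

/-! ### Local maxima of a closed curve -/

/-- The component through `x` of the level set of the height function on `K`. -/
def levelComponent (K : Set E3) (p x : E3) : Set E3 :=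
  connectedComponentIn {y | y ∈ K ∧ inner ℝ p y = inner ℝ p x} x

/-- No point of `K` near the level component of `x` is higher than `x`. -/
def IsPeak (K : Set E3) (p x : E3) : Prop :=
  ∃ U : Set E3, IsOpen U ∧ levelComponent K p x ⊆ U ∧ ∀ y ∈ U ∩ K, inner ℝ p y ≤ inner ℝ p x

theorem isClosed_levelComponent {K : Set E3} (hK : IsClosed K) (p x : E3) :
    IsClosed (levelComponent K p x) := by
  have hF : IsClosed {y | y ∈ K ∧ inner ℝ p y = inner ℝ p x} :=
    hK.inter (isClosed_eq (by fun_prop) continuous_const)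
  unfold levelComponent connectedComponentIn
  split_ifs with h
  · exact hF.isClosedMap_subtype_val _ isClosed_connectedComponent
  · exact isClosed_empty

theorem levelComponent_eq {K : Set E3} {p x y : E3} (h : y ∈ levelComponent K p x) :
    levelComponent K p y = levelComponent K p x := by
  have h1 : inner ℝ p y = inner ℝ p x := (connectedComponentIn_subset _ _ h).2
  unfold levelComponent at *
  rw [h1, connectedComponentIn_eq h]

/-- The times in `[a, b]` at which the curve is in the level component form a closed set. From such
a time it can be extended to the right: near the component the height is at most that of the peak
and by `hge` at least that, so the curve stays on the level. -/
theorem IsPeak.mem_levelComponent {X : ℝ → E3} (hX : Continuous X) (hK : IsClosed (range X))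
    {p : E3} {a b : ℝ} (hab : a ≤ b) (ha : IsPeak (range X) p (X a))
    (hge : ∀ t ∈ Icc a b, inner ℝ p (X a) ≤ inner ℝ p (X t)) :
    X b ∈ levelComponent (range X) p (X a) := by
  obtain ⟨U, hU, hCU, hle⟩ := ha
  set C := levelComponent (range X) p (X a) with hC
  have hcl : IsClosed (X ⁻¹' C) := (isClosed_levelComponent hK p (X a)).preimage hX
  have haC : a ∈ X ⁻¹' C := mem_connectedComponentIn ⟨mem_range_self a, rfl⟩
  refine (hcl.inter isClosed_Icc).Icc_subset_of_forall_exists_gt haC ?_ (right_mem_Icc.2 hab)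
  rintro t ⟨htC, hta, htb⟩ y hty
  have hnhds : X ⁻¹' U ∈ nhds t := (hU.preimage hX).mem_nhds (hCU htC)
  obtain ⟨ε, hε, hball⟩ := Metric.mem_nhds_iff.1 hnhds
  set u := min (min y b) (t + ε / 2) with hu
  have htu : t < u := lt_min (lt_min hty htb) (by linarith)
  have hub : u ≤ b := (min_le_left _ _).trans (min_le_right _ _)
  have hsub : X '' Icc t u ⊆ C := by
    rw [hC, ← levelComponent_eq htC]
    refine (isPreconnected_Icc.image X hX.continuousOn).subset_connectedComponentIn
      (mem_image_of_mem X (left_mem_Icc.2 htu.le)) ?_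
    rintro _ ⟨v, ⟨hv1, hv2⟩, rfl⟩
    refine ⟨mem_range_self v, ?_⟩
    have e1 : inner ℝ p (X t) = inner ℝ p (X a) := (connectedComponentIn_subset _ _ htC).2
    rw [e1]
    refine le_antisymm (hle _ ⟨hball ?_, mem_range_self v⟩) (hge v ⟨by linarith, by linarith⟩)
    have : u ≤ t + ε / 2 := min_le_right _ _
    rw [Metric.mem_ball, Real.dist_eq, abs_of_nonneg] <;> linarith
  exact ⟨u, hsub (mem_image_of_mem X (right_mem_Icc.2 htu.le)), htu,
    (min_le_left _ _).trans (min_le_left _ _)⟩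

/-- Between two different local maxima the height drops strictly below both of them. -/
theorem IsPeak.exists_lower_between {X : ℝ → E3} (hX : Continuous X) (hK : IsClosed (range X))
    {p : E3} {a b : ℝ} (hab : a < b) (ha : IsPeak (range X) p (X a))
    (hb : IsPeak (range X) p (X b))
    (hne : levelComponent (range X) p (X a) ≠ levelComponent (range X) p (X b)) :
    ∃ t, a < t ∧ t < b ∧ inner ℝ p (X t) < inner ℝ p (X a) ∧
      inner ℝ p (X t) < inner ℝ p (X b) := by
  by_contra! hcon
  have key : ∀ t ∈ Icc a b,
      min (inner ℝ p (X a)) (inner ℝ p (X b)) ≤ inner ℝ p (X t) := by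
    rintro t ⟨h1, h2⟩
    rcases h1.eq_or_lt with rfl | h1
    · exact min_le_left _ _
    rcases h2.eq_or_lt with rfl | h2
    · exact min_le_right _ _
    rcases lt_or_ge (inner ℝ p (X t)) (inner ℝ p (X a)) with h3 | h3
    · exact (min_le_right _ _).trans (hcon t h1 h2 h3)
    · exact (min_le_left _ _).trans h3
  rcases le_total (inner ℝ p (X a)) (inner ℝ p (X b)) with hle | hle
  · rw [min_eq_left hle] at key
    exact hne (levelComponent_eq (ha.mem_levelComponent hX hK hab.le key)).symm
  · rw [min_eq_right hle] at key
    have hr : range (fun t => X (-t)) = range X := neg_surjective.range_comp X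
    have := IsPeak.mem_levelComponent (X := fun t => X (-t)) (p := p) (a := -b) (b := -a)
      (hX.comp continuous_neg) (by rwa [hr]) (by linarith) (by simpa [hr] using hb)
      (by
        rintro t ⟨h1, h2⟩
        simpa using key (-t) ⟨by linarith, by linarith⟩)
    simp only [hr, neg_neg] at this
    exact hne (levelComponent_eq this)

theorem Function.Periodic.isClosed_range_of_continuous {X : ℝ → E3} {L : ℝ} (hL : 0 < L)
    (hX : Continuous X) (hper : Function.Periodic X L) : IsClosed (range X) := by
  rw [← hper.image_Icc hL 0]
  exact (isCompact_Icc.image hX).isClosed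

/-- A closed curve whose height function has `N` monotone pieces has at most `N / 2` local maxima,
or a single one. -/
theorem br_le_of_piecewiseMonotone {X : ℝ → E3} {L : ℝ} {N B : ℕ} (hL : 0 < L) (hX : Continuous X)
    (hper : Function.Periodic X L) (p : E3)
    (H : PiecewiseMonotone (fun t => inner ℝ p (X t)) 0 L N) (hB : N / 2 ≤ B) (hB1 : 1 ≤ B) :
    br (range X) p ≤ B := by
  by_contra! hlt
  have hK := Function.Periodic.isClosed_range_of_continuous hL hX hper
  obtain ⟨F, hF, hcard⟩ := Set.exists_subset_encard_eq (Order.add_one_le_of_lt hlt)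
  have hFfin : F.Finite := by
    apply Set.finite_of_encard_eq_coe (k := B + 1)
    simpa using hcard
  have hex : ∀ C ∈ F, ∃ t ∈ Ico 0 L, C = levelComponent (range X) p (X t) ∧
      IsPeak (range X) p (X t) := by
    intro C hC
    obtain ⟨x, hx, rfl, hU⟩ := hF hC
    obtain ⟨s, rfl⟩ := hx
    obtain ⟨t, ht, hst⟩ := hper.exists_mem_Ico₀ hL s
    rw [hst] at hU ⊢
    exact ⟨t, ht, rfl, hU⟩
  choose! τ hτ hτC hτP using hex
  have hinj : InjOn τ F := fun C hC D hD h => by rw [hτC C hC, hτC D hD, h]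
  set S : Finset ℝ := (hFfin.image τ).toFinset with hS
  have hScard : S.card = B + 1 := by
    have h1 : (τ '' F).encard = B + 1 := by rw [hinj.encard_image, hcard]
    rw [hS, ← Set.ncard_eq_toFinset_card _ (hFfin.image τ), Set.ncard, h1]
    rfl
  -- Since `B ≥ 1`, the `B + 1` chosen maxima are `m + 2` in number, at least two, as
  -- `two_mul_le_pieces` needs.
  obtain ⟨m, rfl⟩ : ∃ m, B = m + 1 := ⟨B - 1, by omega⟩
  set e := S.orderEmbOfFin hScard
  have hmem : ∀ k, ∃ C ∈ F, τ C = e k := fun k => by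
    exact (hFfin.image τ).mem_toFinset.1 (S.orderEmbOfFin_mem hScard k)
  have hIco : ∀ k, e k ∈ Ico 0 L := fun k => by
    obtain ⟨C, hC, h⟩ := hmem k
    exact h ▸ hτ C hC
  have hpeak : ∀ k, IsPeak (range X) p (X (e k)) := fun k => by
    obtain ⟨C, hC, h⟩ := hmem k
    exact h ▸ hτP C hC
  have hneq : ∀ k l, k ≠ l →
      levelComponent (range X) p (X (e k)) ≠ levelComponent (range X) p (X (e l)) := by
    intro k l hkl heq
    obtain ⟨C, hC, h⟩ := hmem k
    obtain ⟨D, hD, h'⟩ := hmem l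
    rw [← h, ← h', ← hτC C hC, ← hτC D hD] at heq
    subst heq
    exact hkl (e.injective (h.symm.trans h'))
  let s : ℕ → ℝ := fun k => e (Fin.ofNat (m + 1 + 1) k)
  have hval : ∀ j ≤ m + 1, (Fin.ofNat (m + 1 + 1) j).val = j := fun j hj =>
    Nat.mod_eq_of_lt (by omega)
  have := two_mul_le_pieces (m := m) (s := s) (hper.comp (fun x => inner ℝ p x)) H (hIco _).1
    (hIco _).2 ?_ ?_
  · omega
  · intro j hj
    have hlt : Fin.ofNat (m + 1 + 1) j < Fin.ofNat (m + 1 + 1) (j + 1) := by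
      rw [Fin.lt_def, hval j (by omega), hval (j + 1) (by omega)]; omega
    exact IsPeak.exists_lower_between hX hK (e.strictMono hlt) (hpeak _) (hpeak _)
      (hneq _ _ hlt.ne)
  · have hne : Fin.ofNat (m + 1 + 1) (m + 1) ≠ Fin.ofNat (m + 1 + 1) 0 := by
      rw [Ne, Fin.ext_iff, hval _ le_rfl, hval 0 (by omega)]; omega
    refine IsPeak.exists_lower_between (b := s 0 + L) hX hK ?_ (hpeak _) ?_ ?_
    · have h1 := (hIco (Fin.ofNat (m + 1 + 1) (m + 1))).2
      have h2 := (hIco (Fin.ofNat (m + 1 + 1) 0)).1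
      simp only [s]
      linarith
    · rw [hper]; exact hpeak _
    · rw [hper]; exact hneq _ _ hne

/-! ### Monotone pieces of a planar arc -/

/-- If `α` never reaches `v`, then `c = b` and there is no right part; the guard `c < b` covers that
case. -/
theorem exists_separating_point {α : ℝ → ℝ} {a b v : ℝ} (hab : a ≤ b) (hα : ContinuousOn α (Icc a b))
    (hmono : MonotoneOn α (Icc a b)) (hv : α a ≤ v) :
    ∃ c ∈ Icc a b, (∀ t ∈ Icc a c, α t ≤ v) ∧ ∀ t ∈ Icc c b, c < b → v ≤ α t := by
  rcases le_or_gt v (α b) with hb | hb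
  · obtain ⟨c, hc, rfl⟩ := intermediate_value_Icc hab hα ⟨hv, hb⟩
    exact ⟨c, hc, fun t ht => hmono ⟨ht.1, ht.2.trans hc.2⟩ hc ht.2,
      fun t ht _ => hmono hc ⟨hc.1.trans ht.1, ht.2⟩ ht.1⟩
  · exact ⟨b, right_mem_Icc.2 hab, fun t ht => (hmono ht (right_mem_Icc.2 hab) ht.2).trans hb.le,
      fun t ht h => absurd h (lt_irrefl b)⟩

/-- A function whose derivative has the sign of `sin (α - φ)`, up to a positive factor, for a
monotone function `α` increasing by at most `(j + 1) * π`, has at most `j + 2` monotone pieces. -/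
theorem piecewiseMonotone_of_deriv_sin {h α ρ : ℝ → ℝ} {a b φ : ℝ} (hab : a ≤ b)
    (hα : ContinuousOn α (Icc a b)) (hmono : MonotoneOn α (Icc a b))
    (hρ : ∀ t ∈ Icc a b, 0 ≤ ρ t)
    (hh : ∀ t ∈ Icc a b, HasDerivAt h (-(ρ t * Real.sin (α t - φ))) t) (j : ℕ)
    (hj : α b ≤ α a + j * Real.pi) : PiecewiseMonotone h a b (j + 1) := by
  have base : ∀ c d : ℝ, a ≤ c → c ≤ d → d ≤ b → ∀ k : ℤ,
      (c < d → ∀ t ∈ Icc c d, k * Real.pi ≤ α t - φ ∧ α t - φ ≤ (k + 1) * Real.pi) →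
      MonotoneOn h (Icc c d) ∨ AntitoneOn h (Icc c d) := by
    intro c d hac hcd hdb k hk
    rcases hcd.eq_or_lt with rfl | hcd
    · left; simp
    have hsub : Icc c d ⊆ Icc a b := Icc_subset_Icc hac hdb
    have hcont : ContinuousOn h (Icc c d) := fun t ht =>
      (hh t (hsub ht)).continuousAt.continuousWithinAt
    have hsin : ∀ t ∈ Icc c d, 0 ≤ Real.sin (α t - φ - k * Real.pi) := fun t ht => by
      obtain ⟨h1, h2⟩ := hk hcd t ht
      exact Real.sin_nonneg_of_nonneg_of_le_pi (by linarith) (by linarith)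
    rcases Int.even_or_odd k with hev | hodd
    · right
      refine antitoneOn_of_deriv_nonpos (convex_Icc _ _) hcont
        (fun t ht => (hh t (hsub (interior_subset ht))).differentiableAt.differentiableWithinAt) ?_
      intro t ht
      have ht' := interior_subset ht
      rw [(hh t (hsub ht')).deriv]
      have := hsin t ht'
      rw [Real.sin_sub_int_mul_pi, hev.neg_one_zpow, one_mul] at this
      have := mul_nonneg (hρ t (hsub ht')) this
      linarith
    · left
      refine monotoneOn_of_deriv_nonneg (convex_Icc _ _) hcont
        (fun t ht => (hh t (hsub (interior_subset ht))).differentiableAt.differentiableWithinAt) ?_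
      intro t ht
      have ht' := interior_subset ht
      rw [(hh t (hsub ht')).deriv]
      have := hsin t ht'
      rw [Real.sin_sub_int_mul_pi, hodd.neg_one_zpow] at this
      have := mul_nonneg (hρ t (hsub ht')) this
      linarith
  -- `k` numbers the strip `[kπ, (k + 1)π]` containing the start of `α - φ`; the end lies at most
  -- `j` strips higher. Cutting where `α - φ` leaves strip `k` costs one piece and lowers `j` by
  -- one.
  have step : ∀ (j : ℕ) (c : ℝ) (k : ℤ), c ∈ Icc a b → (c < b → k * Real.pi ≤ α c - φ) →
      α b - φ ≤ (k + 1 + j) * Real.pi → PiecewiseMonotone h c b (j + 1) := by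
    intro j
    induction j with
    | zero =>
      intro c k hc h1 h2
      refine PiecewiseMonotone.refl.snoc hc.2 (base c b hc.1 hc.2 le_rfl k fun hcb t ht => ?_)
      have h3 := hmono hc ⟨hc.1.trans ht.1, ht.2⟩ ht.1
      have h4 := hmono ⟨hc.1.trans ht.1, ht.2⟩ (right_mem_Icc.2 hab) ht.2
      have h5 := h1 hcb
      simp only [Nat.cast_zero, add_zero] at h2
      constructor <;> linarith
    | succ j ih =>
      intro c k hc h1 h2
      have hsub : Icc c b ⊆ Icc a b := Icc_subset_Icc_left hc.1
      rcases le_or_gt (α c) (φ + (k + 1) * Real.pi) with h3 | h3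
      · obtain ⟨d, hd, h4, h5⟩ := exists_separating_point hc.2 (hα.mono hsub) (hmono.mono hsub) h3
        have P1 : PiecewiseMonotone h c d 1 := by
          refine PiecewiseMonotone.refl.snoc hd.1 (base c d hc.1 hd.1 hd.2 k fun hcd t ht => ?_)
          have h6 := hmono hc ⟨hc.1.trans ht.1, ht.2.trans hd.2⟩ ht.1
          have h7 := h1 (hcd.trans_le hd.2)
          have h8 := h4 t ht
          constructor <;> linarith
        have := P1.trans (ih d (k + 1) (hsub hd) (fun hdb => by
          have := h5 d ⟨le_rfl, hd.2⟩ hdb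
          push_cast; linarith) (by push_cast at h2 ⊢; linarith))
        rwa [add_comm] at this
      -- Already past strip `k`: a degenerate one-point piece keeps the count.
      · exact (PiecewiseMonotone.refl.snoc le_rfl (by left; simp)).trans (ih c (k + 1) hc
          (fun _ => by push_cast; linarith) (by push_cast at h2 ⊢; linarith)) |> fun H => by
            rwa [add_comm] at H
  refine step j a ⌊(α a - φ) / Real.pi⌋ (left_mem_Icc.2 hab) (fun _ => ?_) ?_
  · rw [← le_div_iff₀ Real.pi_pos]; exact Int.floor_le _
  · have h1 := (Int.lt_floor_add_one ((α a - φ) / Real.pi)).le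
    rw [div_le_iff₀ Real.pi_pos] at h1
    linarith

/-- The angle between the base direction of a plane curve `θ ↦ (cos θ, sin θ) / w θ` and its
inward normal, in terms of `w` and its derivative. -/
noncomputable def normalAngle (w w' : ℝ → ℝ) (θ : ℝ) : ℝ := θ + Real.arctan (w' θ / w θ)

/-- Up to a positive factor the derivative is `w + w''`, which gives the sign of the curvature of
the polar curve of radius `1 / w`. -/
theorem hasDerivAt_normalAngle {w w' w'' : ℝ → ℝ} {θ : ℝ} (hw : HasDerivAt w (w' θ) θ)
    (hw' : HasDerivAt w' (w'' θ) θ) (hpos : 0 < w θ) :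
    HasDerivAt (normalAngle w w') (w θ * (w θ + w'' θ) / (w θ ^ 2 + w' θ ^ 2)) θ := by
  refine ((hasDerivAt_id θ).add ((hw'.div hw hpos.ne').arctan)).congr_deriv ?_
  have : 0 < w θ ^ 2 + w' θ ^ 2 := by positivity
  simp only [Pi.div_apply]
  field_simp
  ring

theorem continuousOn_normalAngle {w w' w'' : ℝ → ℝ} {s : Set ℝ} (hw : ∀ θ, HasDerivAt w (w' θ) θ)
    (hw' : ∀ θ, HasDerivAt w' (w'' θ) θ) (hpos : ∀ θ ∈ s, 0 < w θ) :
    ContinuousOn (normalAngle w w') s := fun θ hθ =>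
  (hasDerivAt_normalAngle (hw θ) (hw' θ) (hpos θ hθ)).continuousAt.continuousWithinAt

theorem monotoneOn_normalAngle {w w' w'' : ℝ → ℝ} {l : ℝ} (hw : ∀ θ, HasDerivAt w (w' θ) θ)
    (hw' : ∀ θ, HasDerivAt w' (w'' θ) θ) (hpos : ∀ θ ∈ Icc 0 l, 0 < w θ)
    (hconv : ∀ θ ∈ Icc 0 l, 0 ≤ w θ + w'' θ) : MonotoneOn (normalAngle w w') (Icc 0 l) := by
  have hd : ∀ θ ∈ Icc 0 l, _ := fun θ hθ => hasDerivAt_normalAngle (hw θ) (hw' θ) (hpos θ hθ)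
  refine monotoneOn_of_deriv_nonneg (convex_Icc _ _) (continuousOn_normalAngle hw hw' hpos)
    (fun θ hθ => (hd θ (interior_subset hθ)).differentiableAt.differentiableWithinAt) ?_
  intro θ hθ
  have hθ' := interior_subset hθ
  rw [(hd θ hθ').deriv]
  have := hpos θ hθ'
  have := hconv θ hθ'
  positivity

/-- The height of a convex plane arc `θ ↦ (cos θ, sin θ) / w θ` whose normal turns by at most
`j * π` has at most `j + 1` monotone pieces in every direction. -/
theorem piecewiseMonotone_of_convex_arc {w w' w'' : ℝ → ℝ} {l : ℝ} (hl : 0 ≤ l)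
    (hw : ∀ θ, HasDerivAt w (w' θ) θ) (hw' : ∀ θ, HasDerivAt w' (w'' θ) θ)
    (hpos : ∀ θ ∈ Icc 0 l, 0 < w θ) (hconv : ∀ θ ∈ Icc 0 l, 0 ≤ w θ + w'' θ) (j : ℕ)
    (hj : normalAngle w w' l ≤ normalAngle w w' 0 + j * Real.pi) (A B : ℝ) :
    PiecewiseMonotone (fun θ => (A * Real.cos θ + B * Real.sin θ) / w θ) 0 l (j + 1) := by
  -- In polar form `A = R cos φ`, `B = R sin φ`, and with `β = arctan (w' / w)` the derivative of
  -- the height is `-R / (w cos β) * sin (θ + β - φ)`.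
  set z : ℂ := ⟨A, B⟩
  set R := ‖z‖
  set φ := z.arg
  have hA : A = R * Real.cos φ := (Complex.norm_mul_cos_arg z).symm
  have hB : B = R * Real.sin φ := (Complex.norm_mul_sin_arg z).symm
  refine piecewiseMonotone_of_deriv_sin (α := normalAngle w w') (φ := φ)
    (ρ := fun θ => R / (w θ * Real.cos (Real.arctan (w' θ / w θ)))) hl
    (continuousOn_normalAngle hw hw' hpos)
    (monotoneOn_normalAngle hw hw' hpos hconv) ?_ ?_ j hj
  · intro t ht
    have := hpos t ht
    have := Real.cos_arctan_pos (w' t / w t)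
    positivity
  · intro t ht
    have hwt := hpos t ht
    have hcos := Real.cos_arctan_pos (w' t / w t)
    have hd := (((Real.hasDerivAt_cos t).const_mul A).add
      ((Real.hasDerivAt_sin t).const_mul B)).div (hw t) hwt.ne'
    refine hd.congr_deriv ?_
    have htan : Real.sin (Real.arctan (w' t / w t)) =
        w' t / w t * Real.cos (Real.arctan (w' t / w t)) := by
      rw [← Real.tan_mul_cos hcos.ne', Real.tan_arctan]
    have e : normalAngle w w' t - φ = (t - φ) + Real.arctan (w' t / w t) := by
      unfold normalAngle; ring
    rw [e, Real.sin_add, htan, Real.sin_sub, Real.cos_sub]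
    simp only [Pi.add_apply]
    generalize Real.cos (Real.arctan (w' t / w t)) = q at *
    rw [hA, hB]
    field_simp
    ring

open Filter Topology

/-! ### Piecewise linear stretching of the half line -/

/-- The piecewise linear function that is the identity outside `[δ, M]` and sends `a` to `a'` and
`b` to `b'`. -/
noncomputable def stretch (δ M a b a' b' ρ : ℝ) : ℝ :=
  min ρ δ + (a' - δ) / (a - δ) * (max δ (min ρ a) - δ) + (b' - a') / (b - a) * (max a (min ρ b) - a)
    + (M - b') / (M - b) * (max b (min ρ M) - b) + (max ρ M - M)

section stretch

variable {δ M a b a' b' : ℝ}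

theorem stretch_left (h1 : δ < a) (h2 : a < b) (h3 : b < M) : stretch δ M a b a' b' a = a' := by
  have := sub_pos.2 h1
  simp only [stretch, min_eq_right h1.le, min_self, max_eq_right h1.le, min_eq_left h2.le, max_self,
    min_eq_left (h2.trans h3).le, max_eq_left h2.le, max_eq_right (h2.trans h3).le]
  field_simp
  ring

theorem stretch_right (h1 : δ < a) (h2 : a < b) (h3 : b < M) : stretch δ M a b a' b' b = b' := by
  have := sub_pos.2 h1
  have := sub_pos.2 h2
  simp only [stretch, min_eq_right (h1.trans h2).le, min_eq_right h2.le, max_eq_right h1.le,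
    min_self, max_eq_right h2.le, min_eq_left h3.le, max_self, max_eq_right h3.le]
  field_simp
  ring

theorem stretch_of_le (h1 : δ < a) (h2 : a < b) (h3 : b < M) {ρ : ℝ} (h : ρ ≤ δ) :
    stretch δ M a b a' b' ρ = ρ := by
  have e1 : ρ ≤ a := by linarith
  have e2 : ρ ≤ b := by linarith
  have e3 : ρ ≤ M := by linarith
  simp [stretch, min_eq_left h, min_eq_left e1, min_eq_left e2, min_eq_left e3, max_eq_left h,
    max_eq_left e1, max_eq_left e2, max_eq_right e3]

theorem stretch_of_ge (h1 : δ < a) (h2 : a < b) (h3 : b < M) {ρ : ℝ} (h : M ≤ ρ) :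
    stretch δ M a b a' b' ρ = ρ := by
  have := sub_pos.2 h1
  have := sub_pos.2 h2
  have := sub_pos.2 h3
  have e0 : δ ≤ ρ := by linarith
  have e1 : a ≤ ρ := by linarith
  have e2 : b ≤ ρ := by linarith
  simp only [stretch, min_eq_right h, min_eq_right e1, min_eq_right e2, min_eq_right e0,
    max_eq_right h1.le, max_eq_right h2.le, max_eq_right h3.le, max_eq_left h]
  field_simp
  ring

theorem strictMono_stretch (h1 : δ < a) (h2 : a < b) (h3 : b < M) (h1' : δ < a') (h2' : a' < b')
    (h3' : b' < M) : StrictMono (stretch δ M a b a' b') := by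
  intro x y hxy
  have m1 : 0 < (a' - δ) / (a - δ) := div_pos (by linarith) (by linarith)
  have m2 : 0 < (b' - a') / (b - a) := div_pos (by linarith) (by linarith)
  have m3 : 0 < (M - b') / (M - b) := div_pos (by linarith) (by linarith)
  have i0 : min x δ ≤ min y δ := min_le_min_right _ hxy.le
  have i1 : max δ (min x a) ≤ max δ (min y a) := max_le_max_left _ (min_le_min_right _ hxy.le)
  have i2 : max a (min x b) ≤ max a (min y b) := max_le_max_left _ (min_le_min_right _ hxy.le)
  have i3 : max b (min x M) ≤ max b (min y M) := max_le_max_left _ (min_le_min_right _ hxy.le)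
  have i4 : max x M ≤ max y M := max_le_max_right _ hxy.le
  have j1 := mul_le_mul_of_nonneg_left i1 m1.le
  have j2 := mul_le_mul_of_nonneg_left i2 m2.le
  have j3 := mul_le_mul_of_nonneg_left i3 m3.le
  simp only [stretch, mul_sub]
  rcases lt_or_ge x δ with hx | hx
  · have : min x δ < min y δ := by
      rw [min_eq_left hx.le]; exact lt_min hxy hx
    linarith
  rcases lt_or_ge x a with hx1 | hx1
  · have : max δ (min x a) < max δ (min y a) := by
      rw [min_eq_left hx1.le, max_eq_right hx]
      exact (lt_min hxy hx1).trans_le (le_max_right _ _)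
    have := mul_lt_mul_of_pos_left this m1
    linarith
  rcases lt_or_ge x b with hx2 | hx2
  · have : max a (min x b) < max a (min y b) := by
      rw [min_eq_left hx2.le, max_eq_right hx1]
      exact (lt_min hxy hx2).trans_le (le_max_right _ _)
    have := mul_lt_mul_of_pos_left this m2
    linarith
  rcases lt_or_ge x M with hx3 | hx3
  · have : max b (min x M) < max b (min y M) := by
      rw [min_eq_left hx3.le, max_eq_right hx2]
      exact (lt_min hxy hx3).trans_le (le_max_right _ _)
    have := mul_lt_mul_of_pos_left this m3
    linarith
  · have : max x M < max y M := by
      rw [max_eq_left hx3]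
      exact hxy.trans_le (le_max_left _ _)
    linarith

end stretch

/-! ### Radial homeomorphisms -/

/-- The map of three-space that moves the point at distance `ρ` from the origin in the direction
`x` to the distance `k x ρ`. -/
noncomputable def radialMap (k : E3 → ℝ → ℝ) (y : E3) : E3 := (k (‖y‖⁻¹ • y) ‖y‖ * ‖y‖⁻¹) • y

theorem radialMap_smul {k : E3 → ℝ → ℝ} {x : E3} (hx : ‖x‖ = 1) {ρ : ℝ} (hρ : 0 < ρ) :
    radialMap k (ρ • x) = k x ρ • x := by
  have h : ‖ρ • x‖ = ρ := by rw [norm_smul, hx, mul_one, Real.norm_of_nonneg hρ.le]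
  rw [radialMap, h, smul_smul, smul_smul, inv_mul_cancel₀ hρ.ne', one_smul, mul_assoc,
    inv_mul_cancel₀ hρ.ne', mul_one]

theorem radialMap_of_norm_le {k : E3 → ℝ → ℝ} {δ : ℝ} (hk : ∀ x ρ, ρ ≤ δ → k x ρ = ρ) {y : E3}
    (hy : ‖y‖ ≤ δ) : radialMap k y = y := by
  rcases eq_or_ne y 0 with rfl | h0
  · simp [radialMap]
  · rw [radialMap, hk _ _ hy, mul_inv_cancel₀ (norm_ne_zero_iff.2 h0), one_smul]

/-- Polar coordinates break down only at the origin, near which the map is the identity. -/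
theorem continuous_radialMap {P : Type*} [TopologicalSpace P] {k : P → E3 → ℝ → ℝ} {δ : ℝ}
    (hδ : 0 < δ) (hk : Continuous fun q : P × E3 × ℝ => k q.1 q.2.1 q.2.2)
    (hid : ∀ q x ρ, ρ ≤ δ → k q x ρ = ρ) :
    Continuous fun q : P × E3 => radialMap (k q.1) q.2 := by
  rw [continuous_iff_continuousAt]
  rintro ⟨q, y⟩
  rcases eq_or_ne y 0 with rfl | hy
  · refine (continuous_snd.continuousAt (x := (q, (0 : E3)))).congr ?_
    have : ∀ᶠ z : P × E3 in 𝓝 (q, 0), ‖z.2‖ < δ :=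
      (continuous_snd.norm.isOpen_preimage _ isOpen_Iio).mem_nhds (by simpa using hδ)
    filter_upwards [this] with z hz
    exact (radialMap_of_norm_le (hid z.1) hz.le).symm
  · have h1 : ContinuousAt (fun z : P × E3 => ‖z.2‖⁻¹) (q, y) :=
      (continuous_snd.norm.continuousAt).inv₀ (norm_ne_zero_iff.2 hy)
    have h2 : ContinuousAt (fun z : P × E3 => (z.1, ‖z.2‖⁻¹ • z.2, ‖z.2‖)) (q, y) :=
      continuous_fst.continuousAt.prodMk
        ((h1.smul continuous_snd.continuousAt).prodMk continuous_snd.norm.continuousAt)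
    have h3 : ContinuousAt (fun z : P × E3 => k z.1 (‖z.2‖⁻¹ • z.2) ‖z.2‖) (q, y) :=
      ContinuousAt.comp (g := fun q : P × E3 × ℝ => k q.1 q.2.1 q.2.2) hk.continuousAt h2
    exact (h3.mul h1).smul continuous_snd.continuousAt

theorem exists_radial_homeomorph {k : E3 → ℝ → ℝ} {δ M : ℝ} (hδ : 0 < δ)
    (hk : Continuous fun q : E3 × ℝ => k q.1 q.2) (hmono : ∀ x, StrictMono (k x))
    (hid : ∀ x ρ, ρ ≤ δ → k x ρ = ρ) (hid' : ∀ x ρ, M ≤ ρ → k x ρ = ρ) :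
    ∃ H : E3 ≃ₜ E3, ∀ y, H y = radialMap k y := by
  have hk' : Continuous fun q : Unit × E3 × ℝ => k q.2.1 q.2.2 := hk.comp continuous_snd
  have hcont' : Continuous fun q : Unit × E3 => radialMap k q.2 :=
    continuous_radialMap (k := fun _ => k) hδ hk' fun _ => hid
  have hunit : Continuous fun y : E3 => ((), y) := by fun_prop
  have hcont : Continuous (radialMap k) := by
    have := hcont'.comp hunit
    simpa only [Function.comp_def] using this
  have hzero : ∀ x, k x 0 = 0 := fun x => hid x 0 hδ.le
  have hpos : ∀ x ρ, 0 < ρ → 0 < k x ρ := fun x ρ h => by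
    have := hmono x h
    rwa [hzero] at this
  have hpolar : ∀ y : E3, y ≠ 0 → ∃ x : E3, ∃ ρ : ℝ, ‖x‖ = 1 ∧ 0 < ρ ∧ y = ρ • x := fun y hy =>
    ⟨‖y‖⁻¹ • y, ‖y‖, by
      rw [norm_smul, norm_inv, norm_norm, inv_mul_cancel₀ (norm_ne_zero_iff.2 hy)], norm_pos_iff.2 hy, by
      rw [smul_smul, mul_inv_cancel₀ (norm_ne_zero_iff.2 hy), one_smul]⟩
  have hmap0 : radialMap k 0 = 0 := by simp [radialMap]
  have hnorm : ∀ (x : E3) (ρ : ℝ), ‖x‖ = 1 → 0 < ρ → ‖ρ • x‖ = ρ := fun x ρ hx hρ => by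
    rw [norm_smul, hx, mul_one, Real.norm_of_nonneg hρ.le]
  have hne0 : ∀ y, y ≠ 0 → radialMap k y ≠ 0 := by
    intro y hy
    obtain ⟨x, ρ, hx, hρ, rfl⟩ := hpolar y hy
    rw [radialMap_smul hx hρ, ← norm_ne_zero_iff, hnorm x _ hx (hpos x ρ hρ)]
    exact (hpos x ρ hρ).ne'
  have hinj : Function.Injective (radialMap k) := by
    intro y z hyz
    rcases eq_or_ne y 0 with rfl | hy
    · by_contra hz
      exact hne0 z (Ne.symm hz) (hyz.symm.trans hmap0)
    rcases eq_or_ne z 0 with rfl | hz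
    · exact absurd (hyz.trans hmap0) (hne0 y hy)
    obtain ⟨x, ρ, hx, hρ, rfl⟩ := hpolar y hy
    obtain ⟨x', ρ', hx', hρ', rfl⟩ := hpolar z hz
    rw [radialMap_smul hx hρ, radialMap_smul hx' hρ'] at hyz
    have h1 : k x ρ = k x' ρ' := by
      rw [← hnorm x _ hx (hpos x ρ hρ), hyz, hnorm x' _ hx' (hpos x' ρ' hρ')]
    rw [← h1] at hyz
    have h2 : x = x' := smul_right_injective E3 (hpos x ρ hρ).ne' hyz
    subst h2
    rw [(hmono x).injective h1]
  have hsurj : Function.Surjective (radialMap k) := by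
    intro z
    rcases eq_or_ne z 0 with rfl | hz
    · exact ⟨0, hmap0⟩
    obtain ⟨x, ρ, hx, hρ, rfl⟩ := hpolar z hz
    have hkx : Continuous (k x) := hk.comp (Continuous.prodMk_right x)
    have hmem : ρ ∈ Icc (k x 0) (k x (max ρ M)) := by
      rw [hzero, hid' x _ (le_max_right _ _)]
      exact ⟨hρ.le, le_max_left _ _⟩
    obtain ⟨σ, hσ, hkσ⟩ := intermediate_value_Icc (le_max_of_le_left hρ.le) hkx.continuousOn hmem
    have hσ0 : 0 < σ := lt_of_le_of_ne hσ.1 (by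
      rintro rfl
      rw [hzero] at hkσ
      exact hρ.ne hkσ)
    exact ⟨σ • x, by rw [radialMap_smul hx hσ0, hkσ]⟩
  -- Being the identity outside a ball makes the map proper, hence closed, so the continuous
  -- bijection is a homeomorphism.
  have hproper : IsProperMap (radialMap k) := by
    rw [isProperMap_iff_tendsto_cocompact]
    refine ⟨hcont, tendsto_id.congr' ?_⟩
    have : ∀ᶠ y : E3 in cocompact E3, max M 1 ≤ ‖y‖ :=
      (tendsto_norm_cocompact_atTop (E := E3)).eventually_ge_atTop _
    filter_upwards [this] with y hy
    have hy0 : ‖y‖ ≠ 0 := (lt_of_lt_of_le zero_lt_one ((le_max_right _ _).trans hy)).ne'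
    rw [radialMap, hid' _ _ ((le_max_left _ _).trans hy), mul_inv_cancel₀ hy0, one_smul, id]
  exact ⟨(Equiv.ofBijective _ ⟨hinj, hsurj⟩).toHomeomorphOfContinuousClosed hcont
    hproper.isClosedMap, fun y => rfl⟩

/-! ### Changing the radius along a curve on the sphere -/

section Radius

variable {T : Type*} [TopologicalSpace T] [CompactSpace T] [T2Space T] {c : T → E3} {r₀ r₁ : T → ℝ}
  {δ M : ℝ}

/-- Parameters of double points are isolated, so `c` embeds a compact neighbourhood of `τ`; Tietze's
theorem then extends both radii from its image to all of space. -/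
theorem exists_extension_near (hc : Continuous c) (hr₀ : Continuous r₀) (hr₁ : Continuous r₁)
    (hfin : {τ | ∃ τ', τ' ≠ τ ∧ c τ' = c τ}.Finite) (τ : T) :
    ∃ N ∈ 𝓝 τ, ∃ a a' : C(E3, ℝ), ∀ σ ∈ N, a (c σ) = r₀ σ ∧ a' (c σ) = r₁ σ := by
  have hopen : {σ | ∃ τ', τ' ≠ σ ∧ c τ' = c σ}ᶜ ∪ {τ} ∈ 𝓝 τ := by
    have : ({σ | ∃ τ', τ' ≠ σ ∧ c τ' = c σ} \ {τ})ᶜ ∈ 𝓝 τ :=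
      (hfin.subset sdiff_subset).isClosed.isOpen_compl.mem_nhds (by simp)
    rwa [sdiff_eq, compl_inter, compl_compl] at this
  obtain ⟨N, hN, hNc, hNsub⟩ := exists_mem_nhds_isClosed_subset hopen
  have hinj : Function.Injective fun σ : N => c σ := by
    rintro ⟨σ, hσ⟩ ⟨σ', hσ'⟩ h
    by_contra hne
    have hne' : σ ≠ σ' := fun h => hne (Subtype.ext h)
    have h1 : σ = τ := (hNsub hσ).resolve_left fun h' => h' ⟨σ', hne'.symm, h.symm⟩
    have h2 : σ' = τ := (hNsub hσ').resolve_left fun h' => h' ⟨σ, hne', h⟩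
    exact hne' (h1.trans h2.symm)
  have : CompactSpace N := isCompact_iff_compactSpace.1 hNc.isCompact
  have hemb : IsClosedEmbedding fun σ : N => c σ :=
    (hc.comp continuous_subtype_val).isClosedEmbedding hinj
  obtain ⟨a, ha⟩ := ContinuousMap.exists_extension' hemb ⟨fun σ : N => r₀ σ, by fun_prop⟩
  obtain ⟨a', ha'⟩ := ContinuousMap.exists_extension' hemb ⟨fun σ : N => r₁ σ, by fun_prop⟩
  exact ⟨N, hN, a, a', fun σ hσ => ⟨congrFun ha ⟨σ, hσ⟩, congrFun ha' ⟨σ, hσ⟩⟩⟩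

/-- At most two strands pass over `x`; `a`, `a'` extend the two radii of the lower one and `b`, `b'`
those of the upper one. Missing strands are replaced by constants, so that the stretch always has
two interior nodes. -/
theorem exists_branches (hc : Continuous c) (hr₀ : Continuous r₀) (hr₁ : Continuous r₁)
    (hfin : {τ | ∃ τ', τ' ≠ τ ∧ c τ' = c τ}.Finite)
    (htriple : ∀ τ τ' τ'', τ' ≠ τ → τ'' ≠ τ → c τ' = c τ → c τ'' = c τ → τ' = τ'')
    (horder : ∀ τ τ', τ ≠ τ' → c τ = c τ' → 0 < (r₀ τ - r₀ τ') * (r₁ τ - r₁ τ'))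
    (hδM : δ < M) (hb₀ : ∀ τ, r₀ τ ∈ Ioo δ M) (hb₁ : ∀ τ, r₁ τ ∈ Ioo δ M) (x : E3) :
    ∃ W : Set T, IsOpen W ∧ (∀ τ, c τ = x → τ ∈ W) ∧ ∃ a b a' b' : C(E3, ℝ),
      (δ < a x ∧ a x < b x ∧ b x < M ∧ δ < a' x ∧ a' x < b' x ∧ b' x < M) ∧
      ∀ τ ∈ W, (a (c τ) = r₀ τ ∧ a' (c τ) = r₁ τ) ∨ (b (c τ) = r₀ τ ∧ b' (c τ) = r₁ τ) := by
  by_cases h1 : ∃ τ, c τ = x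
  swap
  · push Not at h1
    obtain ⟨m, hm1, hm2⟩ := exists_between hδM
    obtain ⟨m', hm1', hm2'⟩ := exists_between hm2
    exact ⟨∅, isOpen_empty, fun τ h => (h1 τ h).elim, .const _ m, .const _ m', .const _ m,
      .const _ m', ⟨hm1, hm1', hm2', hm1, hm1', hm2'⟩, fun τ h => h.elim⟩
  obtain ⟨τ, rfl⟩ := h1
  have two : ∀ τ τ', τ' ≠ τ → c τ' = c τ → r₀ τ < r₀ τ' →
      ∃ W : Set T, IsOpen W ∧ (∀ σ, c σ = c τ → σ ∈ W) ∧ ∃ a b a' b' : C(E3, ℝ),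
      (δ < a (c τ) ∧ a (c τ) < b (c τ) ∧ b (c τ) < M ∧ δ < a' (c τ) ∧ a' (c τ) < b' (c τ) ∧
        b' (c τ) < M) ∧
      ∀ τ ∈ W, (a (c τ) = r₀ τ ∧ a' (c τ) = r₁ τ) ∨ (b (c τ) = r₀ τ ∧ b' (c τ) = r₁ τ) := by
    intro τ τ' hne heq hlt
    obtain ⟨N, hN, a, a', ha⟩ := exists_extension_near hc hr₀ hr₁ hfin τ
    obtain ⟨N', hN', b, b', hb⟩ := exists_extension_near hc hr₀ hr₁ hfin τ'
    have hlt' : r₁ τ < r₁ τ' := by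
      have := horder τ τ' hne.symm heq.symm
      have := neg_of_mul_pos_right this (by linarith)
      linarith
    refine ⟨interior N ∪ interior N', isOpen_interior.union isOpen_interior, fun σ hσ => ?_,
      a, b, a', b', ?_, ?_⟩
    · by_cases h : σ = τ
      · exact .inl (h ▸ mem_interior_iff_mem_nhds.2 hN)
      · rw [htriple τ σ τ' h hne hσ heq]
        exact .inr (mem_interior_iff_mem_nhds.2 hN')
    · obtain ⟨e1, e2⟩ := ha τ (mem_of_mem_nhds hN)
      obtain ⟨e3, e4⟩ := hb τ' (mem_of_mem_nhds hN')
      rw [heq] at e3 e4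
      rw [e1, e2, e3, e4]
      exact ⟨(hb₀ τ).1, hlt, (hb₀ τ').2, (hb₁ τ).1, hlt', (hb₁ τ').2⟩
    · rintro σ (hσ | hσ)
      · exact .inl (ha σ (interior_subset hσ))
      · exact .inr (hb σ (interior_subset hσ))
  by_cases h2 : ∃ τ', τ' ≠ τ ∧ c τ' = c τ
  · obtain ⟨τ', hne, heq⟩ := h2
    have hr : r₀ τ ≠ r₀ τ' := fun h => by
      have := horder τ τ' hne.symm heq.symm
      rw [h, sub_self, zero_mul] at this
      exact this.false
    rcases hr.lt_or_gt with h | h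
    · exact two τ τ' hne heq h
    · rw [← heq]
      exact two τ' τ hne.symm heq.symm h
  · push Not at h2
    obtain ⟨N, hN, a, a', ha⟩ := exists_extension_near hc hr₀ hr₁ hfin τ
    obtain ⟨e1, e2⟩ := ha τ (mem_of_mem_nhds hN)
    obtain ⟨m, hm1, hm2⟩ := exists_between (hb₀ τ).2
    obtain ⟨m', hm1', hm2'⟩ := exists_between (hb₁ τ).2
    refine ⟨interior N, isOpen_interior, fun σ hσ => ?_, a, .const _ m, a', .const _ m', ?_,
      fun σ hσ => .inl (ha σ (interior_subset hσ))⟩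
    · by_cases h : σ = τ
      · exact h ▸ mem_interior_iff_mem_nhds.2 hN
      · exact absurd hσ (h2 σ h)
    · rw [e1, e2]
      exact ⟨(hb₀ τ).1, hm1, hm2, (hb₁ τ).1, hm1', hm2'⟩

/-- Two radius functions along the same curve on the sphere, in the same order at each double point,
are related by a continuous family of increasing homeomorphisms of the rays. -/
theorem exists_fibrewise_stretch (hc : Continuous c) (hr₀ : Continuous r₀) (hr₁ : Continuous r₁)
    (hfin : {τ | ∃ τ', τ' ≠ τ ∧ c τ' = c τ}.Finite)
    (htriple : ∀ τ τ' τ'', τ' ≠ τ → τ'' ≠ τ → c τ' = c τ → c τ'' = c τ → τ' = τ'')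
    (horder : ∀ τ τ', τ ≠ τ' → c τ = c τ' → 0 < (r₀ τ - r₀ τ') * (r₁ τ - r₁ τ'))
    (hδM : δ < M) (hb₀ : ∀ τ, r₀ τ ∈ Ioo δ M) (hb₁ : ∀ τ, r₁ τ ∈ Ioo δ M) :
    ∃ h : C(E3, C(ℝ, ℝ)), ∀ x, StrictMono (h x) ∧ (∀ ρ ≤ δ, h x ρ = ρ) ∧ (∀ ρ, M ≤ ρ → h x ρ = ρ) ∧
      ∀ τ, c τ = x → h x (r₀ τ) = r₁ τ := by
  -- The conditions on the stretch of a single ray are convex, so local continuous choices can be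
  -- patched by a partition of unity.
  refine exists_continuous_forall_mem_convex_of_local
    (t := fun x => {f : C(ℝ, ℝ) | StrictMono f ∧ (∀ ρ ≤ δ, f ρ = ρ) ∧ (∀ ρ, M ≤ ρ → f ρ = ρ) ∧
      ∀ τ, c τ = x → f (r₀ τ) = r₁ τ}) ?_ ?_
  · rintro x f ⟨f1, f2, f3, f4⟩ g ⟨g1, g2, g3, g4⟩ s t hs ht hst
    have comb : ∀ z : ℝ, s * z + t * z = z := fun z => by rw [← add_mul, hst, one_mul]
    refine ⟨fun y z hyz => ?_, fun ρ hρ => ?_, fun ρ hρ => ?_, fun τ hτ => ?_⟩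
    · have h1 := f1 hyz
      have h2 := g1 hyz
      simp only [ContinuousMap.add_apply, ContinuousMap.smul_apply, smul_eq_mul]
      rcases hs.eq_or_lt with rfl | hs
      · rw [zero_add] at hst
        subst hst
        linarith
      · have := mul_lt_mul_of_pos_left h1 hs
        have := mul_le_mul_of_nonneg_left h2.le ht
        linarith
    · simp [f2 ρ hρ, g2 ρ hρ, comb]
    · simp [f3 ρ hρ, g3 ρ hρ, comb]
    · simp [f4 τ hτ, g4 τ hτ, comb]
  · intro x
    obtain ⟨W, hW, hfib, a, b, a', b', hx, hbr⟩ :=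
      exists_branches hc hr₀ hr₁ hfin htriple horder hδM hb₀ hb₁ x
    set U : Set E3 := {y | δ < a y ∧ a y < b y ∧ b y < M ∧ δ < a' y ∧ a' y < b' y ∧ b' y < M} with hU
    have hUo : IsOpen U := by
      have e1 : IsOpen {y | δ < a y} := isOpen_lt continuous_const a.continuous
      have e2 : IsOpen {y | a y < b y} := isOpen_lt a.continuous b.continuous
      have e3 : IsOpen {y | b y < M} := isOpen_lt b.continuous continuous_const
      have e4 : IsOpen {y | δ < a' y} := isOpen_lt continuous_const a'.continuous
      have e5 : IsOpen {y | a' y < b' y} := isOpen_lt a'.continuous b'.continuous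
      have e6 : IsOpen {y | b' y < M} := isOpen_lt b'.continuous continuous_const
      exact e1.inter (e2.inter (e3.inter (e4.inter (e5.inter e6))))
    -- Off this compact image of the remaining parameters, every strand over a point `y` belongs to
    -- one of the two branches.
    have hcl : IsClosed (c '' Wᶜ) := (hW.isClosed_compl.isCompact.image hc).isClosed
    have hxW : x ∉ c '' Wᶜ := by
      rintro ⟨τ, hτ, rfl⟩
      exact hτ (hfib τ rfl)
    -- Joint continuity in the point and the radius gives, by currying, continuity into the space of
    -- maps of the ray.
    let F : C(U × ℝ, ℝ) := ⟨fun q => stretch δ M (a q.1) (b q.1) (a' q.1) (b' q.1) q.2, by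
      unfold stretch
      have n1 : ∀ q : U × ℝ, a q.1 - δ ≠ 0 := fun q => (sub_pos.2 q.1.2.1).ne'
      have n2 : ∀ q : U × ℝ, b q.1 - a q.1 ≠ 0 := fun q => (sub_pos.2 q.1.2.2.1).ne'
      have n3 : ∀ q : U × ℝ, M - b q.1 ≠ 0 := fun q => (sub_pos.2 q.1.2.2.2.1).ne'
      fun_prop (disch := assumption)⟩
    classical
    refine ⟨U ∩ (c '' Wᶜ)ᶜ, (hUo.inter hcl.isOpen_compl).mem_nhds ⟨hx, hxW⟩,
      fun y => if hy : y ∈ U then F.curry ⟨y, hy⟩ else 0, ?_, ?_⟩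
    · refine ContinuousOn.mono ?_ inter_subset_left
      rw [continuousOn_iff_continuous_domRestrict]
      refine F.curry.continuous.congr fun y => ?_
      simp
    · rintro y ⟨hy, hyW⟩
      have hval : ∀ ρ, (F.curry ⟨y, hy⟩) ρ = stretch δ M (a y) (b y) (a' y) (b' y) ρ := fun ρ => rfl
      obtain ⟨h1, h2, h3, h4, h5, h6⟩ := id hy
      simp only [dif_pos hy]
      refine ⟨fun ρ σ h => ?_, fun ρ hρ => ?_, fun ρ hρ => ?_, fun τ hτ => ?_⟩
      · rw [hval, hval]
        exact strictMono_stretch h1 h2 h3 h4 h5 h6 h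
      · rw [hval, stretch_of_le h1 h2 h3 hρ]
      · rw [hval, stretch_of_ge h1 h2 h3 hρ]
      · have hτW : τ ∈ W := by
          by_contra h
          exact hyW ⟨τ, h, hτ⟩
        subst hτ
        rw [hval]
        rcases hbr τ hτW with ⟨e1, e2⟩ | ⟨e1, e2⟩
        · rw [← e1, ← e2, stretch_left h1 h2 h3]
        · rw [← e1, ← e2, stretch_right h1 h2 h3]

theorem ambientIsotopic_of_radii [Nonempty T] (hc : Continuous c) (hr₀ : Continuous r₀)
    (hr₁ : Continuous r₁) (hnorm : ∀ τ, ‖c τ‖ = 1) (hpos₀ : ∀ τ, 0 < r₀ τ) (hpos₁ : ∀ τ, 0 < r₁ τ)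
    (hfin : {τ | ∃ τ', τ' ≠ τ ∧ c τ' = c τ}.Finite)
    (htriple : ∀ τ τ' τ'', τ' ≠ τ → τ'' ≠ τ → c τ' = c τ → c τ'' = c τ → τ' = τ'')
    (horder : ∀ τ τ', τ ≠ τ' → c τ = c τ' → 0 < (r₀ τ - r₀ τ') * (r₁ τ - r₁ τ')) :
    AmbientIsotopic (range fun τ => r₀ τ • c τ) (range fun τ => r₁ τ • c τ) := by
  have bounds : ∀ r : T → ℝ, Continuous r → (∀ τ, 0 < r τ) →
      ∃ δ M : ℝ, 0 < δ ∧ ∀ τ, r τ ∈ Ioo δ M := by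
    intro r hr hpos
    obtain ⟨τ₀, -, h0⟩ := isCompact_univ.exists_isMinOn univ_nonempty hr.continuousOn
    obtain ⟨τ₁, -, h1⟩ := isCompact_univ.exists_isMaxOn univ_nonempty hr.continuousOn
    refine ⟨r τ₀ / 2, r τ₁ + 1, half_pos (hpos _), fun τ => ⟨?_, ?_⟩⟩
    · have : r τ₀ ≤ r τ := h0 (mem_univ τ)
      have := hpos τ₀
      linarith
    · have : r τ ≤ r τ₁ := h1 (mem_univ τ)
      linarith
  obtain ⟨δ₀, M₀, hδ₀, hb₀⟩ := bounds r₀ hr₀ hpos₀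
  obtain ⟨δ₁, M₁, hδ₁, hb₁⟩ := bounds r₁ hr₁ hpos₁
  set δ := min δ₀ δ₁
  set M := max M₀ M₁
  have hδ : 0 < δ := lt_min hδ₀ hδ₁
  have hb₀' : ∀ τ, r₀ τ ∈ Ioo δ M := fun τ =>
    ⟨(min_le_left _ _).trans_lt (hb₀ τ).1, (hb₀ τ).2.trans_le (le_max_left _ _)⟩
  have hb₁' : ∀ τ, r₁ τ ∈ Ioo δ M := fun τ =>
    ⟨(min_le_right _ _).trans_lt (hb₁ τ).1, (hb₁ τ).2.trans_le (le_max_right _ _)⟩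
  have hδM : δ < M := let τ := Classical.arbitrary T; (hb₀' τ).1.trans (hb₀' τ).2
  obtain ⟨h, hh⟩ := exists_fibrewise_stretch hc hr₀ hr₁ hfin htriple horder hδM hb₀' hb₁'
  -- Convex combinations with the identity stay strictly increasing, so every time of the isotopy is
  -- a homeomorphism.
  let k : unitInterval → E3 → ℝ → ℝ := fun t x ρ => (1 - t) * ρ + t * h x ρ
  have hheval : Continuous fun q : E3 × ℝ => h q.1 q.2 :=
    ContinuousEval.continuous_eval.comp (h.continuous.prodMap continuous_id)
  have hkc : Continuous fun q : unitInterval × E3 × ℝ => k q.1 q.2.1 q.2.2 := by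
    have := hheval.comp (continuous_snd (X := unitInterval))
    have e : Continuous fun q : unitInterval × E3 × ℝ => h q.2.1 q.2.2 := this
    simp only [k]
    fun_prop
  have hmono : ∀ t x, StrictMono (k t x) := by
    intro t x ρ σ hρσ
    have h1 := (hh x).1 hρσ
    have t0 := t.2.1
    have t1 := t.2.2
    simp only [k]
    rcases t0.eq_or_lt with h0 | h0
    · rw [← h0]; linarith
    · have := mul_lt_mul_of_pos_left h1 h0
      have := mul_le_mul_of_nonneg_left hρσ.le (sub_nonneg.2 t1)
      linarith
  have hid : ∀ t x ρ, ρ ≤ δ → k t x ρ = ρ := fun t x ρ hρ => by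
    simp only [k, (hh x).2.1 ρ hρ]; ring
  have hid' : ∀ t x ρ, M ≤ ρ → k t x ρ = ρ := fun t x ρ hρ => by
    simp only [k, (hh x).2.2.1 ρ hρ]; ring
  have hex : ∀ t, ∃ H : E3 ≃ₜ E3, ∀ y, H y = radialMap (k t) y := fun t =>
    exists_radial_homeomorph hδ (hkc.comp (Continuous.prodMk_right t)) (hmono t) (hid t) (hid' t)
  choose H hH using hex
  refine ⟨H, ?_, ?_, ?_⟩
  · simp only [hH]
    exact continuous_radialMap hδ hkc hid
  · intro y
    rw [hH]
    rcases eq_or_ne y 0 with rfl | hy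
    · simp [radialMap]
    · simp [radialMap, k, mul_inv_cancel₀ (norm_ne_zero_iff.2 hy)]
  · rw [← range_comp]
    congr 1
    funext τ
    rw [Function.comp_apply, hH, radialMap_smul (hnorm τ) (hpos₀ τ)]
    simp [k, (hh (c τ)).2.2.2 τ rfl]

end Radius

/-- The version of `ambientIsotopic_of_radii` for periodic functions. -/
theorem ambientIsotopic_of_periodic_radii {L : ℝ} (hL : 0 < L) {c : ℝ → E3} {r₀ r₁ : ℝ → ℝ}
    (hc : Continuous c) (hr₀ : Continuous r₀) (hr₁ : Continuous r₁)
    (pc : Function.Periodic c L) (pr₀ : Function.Periodic r₀ L) (pr₁ : Function.Periodic r₁ L)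
    (hnorm : ∀ s, ‖c s‖ = 1) (hpos₀ : ∀ s, 0 < r₀ s) (hpos₁ : ∀ s, 0 < r₁ s)
    (hfin : {x | x ∈ Ico 0 L ∧ ∃ y ∈ Ico 0 L, y ≠ x ∧ c y = c x}.Finite)
    (htriple : ∀ x ∈ Ico 0 L, ∀ y ∈ Ico 0 L, ∀ z ∈ Ico 0 L, y ≠ x → z ≠ x → c y = c x → c z = c x →
      y = z)
    (horder : ∀ x ∈ Ico 0 L, ∀ y ∈ Ico 0 L, x ≠ y → c x = c y →
      0 < (r₀ x - r₀ y) * (r₁ x - r₁ y)) :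
    AmbientIsotopic (range fun s => r₀ s • c s) (range fun s => r₁ s • c s) := by
  have : Fact (0 < L) := ⟨hL⟩
  have hmk : ∀ τ : AddCircle L, ∃ x ∈ Ico 0 L, (x : AddCircle L) = τ := fun τ => by
    have := (AddCircle.equivIco L 0 τ).2
    exact ⟨_, ⟨this.1, this.2.trans_eq (zero_add L)⟩, AddCircle.coe_equivIco⟩
  have cont {Y : Type} [TopologicalSpace Y] {f : ℝ → Y} (hf : Continuous f)
      (pf : Function.Periodic f L) : Continuous pf.lift :=
    (QuotientAddGroup.isQuotientMap_mk _).continuous_iff.2 hf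
  have ran (r : ℝ → ℝ) (pr : Function.Periodic r L) :
      (range fun s => r s • c s) = range fun τ => pr.lift τ • pc.lift τ := by
    ext y
    constructor
    · rintro ⟨s, rfl⟩
      exact ⟨s, rfl⟩
    · rintro ⟨τ, rfl⟩
      obtain ⟨x, -, rfl⟩ := hmk τ
      exact ⟨x, rfl⟩
  have ne {x y : ℝ} (h : (x : AddCircle L) ≠ y) : x ≠ y := fun e => h (congrArg _ e)
  rw [ran r₀ pr₀, ran r₁ pr₁]
  refine ambientIsotopic_of_radii (cont hc pc) (cont hr₀ pr₀) (cont hr₁ pr₁) ?_ ?_ ?_ ?_ ?_ ?_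
  · intro τ
    obtain ⟨x, -, rfl⟩ := hmk τ
    exact hnorm x
  · intro τ
    obtain ⟨x, -, rfl⟩ := hmk τ
    exact hpos₀ x
  · intro τ
    obtain ⟨x, -, rfl⟩ := hmk τ
    exact hpos₁ x
  · refine (hfin.image ((↑) : ℝ → AddCircle L)).subset ?_
    rintro τ ⟨τ', h1, h2⟩
    obtain ⟨x, hx, rfl⟩ := hmk τ
    obtain ⟨y, hy, rfl⟩ := hmk τ'
    exact ⟨x, ⟨hx, y, hy, ne h1, h2⟩, rfl⟩
  · intro τ τ' τ'' h1 h2 h3 h4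
    obtain ⟨x, hx, rfl⟩ := hmk τ
    obtain ⟨y, hy, rfl⟩ := hmk τ'
    obtain ⟨z, hz, rfl⟩ := hmk τ''
    rw [htriple x hx y hy z hz (ne h1) (ne h2) h3 h4]
  · intro τ τ' h1 h2
    obtain ⟨x, hx, rfl⟩ := hmk τ
    obtain ⟨y, hy, rfl⟩ := hmk τ'
    exact horder x hx y hy (ne h1) h2

/-! ### Functions glued from functions on unit intervals -/

/-- The function on the line that runs through `f i` on the intervals `[k, k + 1]` with `k ≡ i`
modulo `n`. -/
noncomputable def glue {n : ℕ} {Y : Type*} (f : ZMod n → ℝ → Y) (x : ℝ) : Y :=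
  f (⌊x⌋ : ZMod n) (Int.fract x)

section glue

variable {n : ℕ} {Y : Type*} {f : ZMod n → ℝ → Y}

theorem glue_periodic (f : ZMod n → ℝ → Y) : Function.Periodic (glue f) n := by
  intro x
  simp [glue]

theorem glue_eqOn (hf : ∀ i, f i 1 = f (i + 1) 0) (k : ℤ) :
    EqOn (glue f) (fun x => f (k : ZMod n) (x - k)) (Icc (k : ℝ) (k + 1)) := by
  rintro x ⟨h1, h2⟩
  rcases h2.eq_or_lt with rfl | h2
  · have : (k : ℝ) + 1 = ((k + 1 : ℤ) : ℝ) := by push_cast; ring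
    simp only [glue]
    rw [this, Int.floor_intCast, Int.fract_intCast]
    push_cast
    rw [add_sub_cancel_left, hf]
  · have : ⌊x⌋ = k := Int.floor_eq_iff.2 ⟨h1, h2⟩
    simp only [glue, Int.fract, this]

theorem continuous_glue [TopologicalSpace Y] (hc : ∀ i, Continuous (f i))
    (hf : ∀ i, f i 1 = f (i + 1) 0) : Continuous (glue f) := by
  have hlf : LocallyFinite fun k : ℤ => Icc (k : ℝ) (k + 1) :=
    locallyFinite_Icc_of_tendsto tendsto_intCast_atTop_atTop
      (Filter.tendsto_atBot_add_const_right _ _ (tendsto_intCast_atBot_iff.2 Filter.tendsto_id))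
  refine hlf.continuous ?_ (fun k => isClosed_Icc) fun k => ?_
  · refine eq_univ_of_forall fun x => mem_iUnion.2 ⟨⌊x⌋, Int.floor_le x, (Int.lt_floor_add_one x).le⟩
  · refine ContinuousOn.congr ?_ (glue_eqOn hf k)
    have := hc (k : ZMod n)
    exact Continuous.continuousOn (by fun_prop)

end glue

namespace StickCurve

variable {n : ℕ} (γ : StickCurve n)

theorem continuous_arc (i : ZMod n) : Continuous (γ.arc i) := by
  unfold arc
  fun_prop

theorem arc_one (i : ZMod n) : γ.arc i 1 = γ.arc (i + 1) 0 := by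
  simp [arc, γ.closed i]

theorem continuous_curve : Continuous γ.curve :=
  continuous_glue γ.continuous_arc γ.arc_one

theorem curve_periodic : Function.Periodic γ.curve n := glue_periodic _

theorem norm_cos_add_sin (i : ZMod n) (θ : ℝ) :
    ‖Real.cos θ • γ.base i + Real.sin θ • γ.dir i‖ = 1 := by
  rw [← sq_eq_sq₀ (norm_nonneg _) zero_le_one, norm_add_sq_real, norm_smul, norm_smul,
    inner_smul_left, inner_smul_right, γ.orthogonal, γ.norm_base, γ.norm_dir]
  simp

theorem norm_curve (x : ℝ) : ‖γ.curve x‖ = 1 := γ.norm_cos_add_sin _ _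

end StickCurve

/-! ### Polynomials with prescribed values, flat at the ends of the unit interval -/

/-- The factor `(X (1 - X))²` makes value and slope vanish at both ends; the values are interpolated
after division by it. -/
theorem exists_flat_polynomial {ι : Type*} (S : Finset ι) (t v : ι → ℝ) (hinj : Set.InjOn t S)
    (ht : ∀ x ∈ S, t x ∈ Ioo (0 : ℝ) 1) :
    ∃ Q : Polynomial ℝ, Q.eval 0 = 0 ∧ Q.eval 1 = 0 ∧ Q.derivative.eval 0 = 0 ∧
      Q.derivative.eval 1 = 0 ∧ ∀ x ∈ S, Q.eval (t x) = v x := by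
  classical
  refine ⟨(Polynomial.X * (1 - Polynomial.X)) ^ 2 *
    Lagrange.interpolate S t fun x => v x / (t x * (1 - t x)) ^ 2, ?_, ?_, ?_, ?_, ?_⟩
  · simp
  · simp
  · simp [Polynomial.derivative_mul, Polynomial.derivative_pow]
  · simp [Polynomial.derivative_mul, Polynomial.derivative_pow]
  · intro x hx
    have h1 := (ht x hx).1
    have h2 := sub_pos.2 (ht x hx).2
    simp only [Polynomial.eval_mul, Polynomial.eval_pow, Polynomial.eval_X, Polynomial.eval_sub,
      Polynomial.eval_one, Lagrange.eval_interpolate_at_node _ hinj hx]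
    field_simp

theorem exists_flat_polynomials {n : ℕ} (S : Set ℝ) (hS : S.Finite) (hSn : S ⊆ Ico (0 : ℝ) n)
    (hfract : ∀ x ∈ S, Int.fract x ≠ 0) (v : ℝ → ℝ) :
    ∃ Q : ZMod n → Polynomial ℝ, (∀ i, (Q i).eval 0 = 0 ∧ (Q i).eval 1 = 0 ∧
      (Q i).derivative.eval 0 = 0 ∧ (Q i).derivative.eval 1 = 0) ∧
      ∀ x ∈ S, glue (fun i t => (Q i).eval t) x = v x := by
  classical
  have key : ∀ i : ZMod n, ∃ Q : Polynomial ℝ, Q.eval 0 = 0 ∧ Q.eval 1 = 0 ∧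
      Q.derivative.eval 0 = 0 ∧ Q.derivative.eval 1 = 0 ∧
      ∀ x ∈ hS.toFinset.filter (fun x => (⌊x⌋ : ZMod n) = i), Q.eval (Int.fract x) = v x := by
    intro i
    refine exists_flat_polynomial _ _ _ ?_ ?_
    · intro x hx y hy hxy
      simp only [Finset.coe_filter, Finite.mem_toFinset, mem_ofPred_eq] at hx hy
      have hfl : ∀ z ∈ S, 0 ≤ ⌊z⌋ ∧ ⌊z⌋ < n := fun z hz =>
        ⟨Int.floor_nonneg.2 (hSn hz).1, Int.floor_lt.2 (by exact_mod_cast (hSn hz).2)⟩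
      have h1 := (ZMod.intCast_eq_intCast_iff _ _ n).1 (hx.2.trans hy.2.symm)
      have h2 : ⌊x⌋ = ⌊y⌋ := by
        have := h1.eq
        rwa [Int.emod_eq_of_lt (hfl x hx.1).1 (hfl x hx.1).2,
          Int.emod_eq_of_lt (hfl y hy.1).1 (hfl y hy.1).2] at this
      rw [← Int.floor_add_fract x, ← Int.floor_add_fract y, h2, hxy]
    · intro x hx
      simp only [Finset.mem_filter, Finite.mem_toFinset] at hx
      exact ⟨lt_of_le_of_ne (Int.fract_nonneg x) (hfract x hx.1).symm, Int.fract_lt_one x⟩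
  choose Q h0 h1 h2 h3 h4 using key
  refine ⟨Q, fun i => ⟨h0 i, h1 i, h2 i, h3 i⟩, fun x hx => h4 _ x ?_⟩
  simp [hx]

/-! ### Perturbed elliptical arcs -/

/-- A great circle arc of length `l ≤ 2 * π`, moved to an ellipse with focus at the origin and
slightly perturbed away from its ends, has at most `j + 1` monotone pieces, for `j = 2` and for every
`j` such that `j * π` bounds the turning of the normal. -/
theorem piecewiseMonotone_of_perturbed_ellipse {l a₁ a₂ e ε : ℝ} (hl : 0 < l)
    {Q : Polynomial ℝ} (h0 : Q.eval 0 = 0) (h1 : Q.eval 1 = 0) (h2 : Q.derivative.eval 0 = 0)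
    (h3 : Q.derivative.eval 1 = 0) (ha : ∀ θ, a₁ * Real.cos θ + a₂ * Real.sin θ ≤ e) (he : e < 1)
    (hε : ∀ t ∈ Icc (0 : ℝ) 1, -(1 - e) < ε * Q.eval t)
    (hε' : ∀ t ∈ Icc (0 : ℝ) 1, -1 ≤ ε * (Q.eval t + Q.derivative.derivative.eval t / l ^ 2))
    (j : ℕ)
    (hj : (j = 2 ∧ l ≤ 2 * Real.pi) ∨
      l + Real.arctan ((a₁ * Real.sin l - a₂ * Real.cos l) /
        (1 - (a₁ * Real.cos l + a₂ * Real.sin l))) ≤ Real.arctan (-a₂ / (1 - a₁)) + j * Real.pi)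
    (A B : ℝ) :
    PiecewiseMonotone (fun θ => (A * Real.cos θ + B * Real.sin θ) /
      (1 - (a₁ * Real.cos θ + a₂ * Real.sin θ) + ε * Q.eval (θ / l))) 0 l (j + 1) := by
  set w : ℝ → ℝ := fun θ => 1 - (a₁ * Real.cos θ + a₂ * Real.sin θ) with hw
  set w' : ℝ → ℝ := fun θ => a₁ * Real.sin θ - a₂ * Real.cos θ with hw'
  set w'' : ℝ → ℝ := fun θ => a₁ * Real.cos θ + a₂ * Real.sin θ with hw''
  have d1 : ∀ θ, HasDerivAt w (w' θ) θ := fun θ =>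
    ((((Real.hasDerivAt_cos θ).const_mul a₁).add
      ((Real.hasDerivAt_sin θ).const_mul a₂)).const_sub 1).congr_deriv (by simp only [hw']; ring)
  have d2 : ∀ θ, HasDerivAt w' (w'' θ) θ := fun θ =>
    (((Real.hasDerivAt_sin θ).const_mul a₁).sub
      ((Real.hasDerivAt_cos θ).const_mul a₂)).congr_deriv (by simp only [hw'']; ring)
  -- For `j = 2`: the normal of the full ellipse turns by exactly `2π`, and the angle is monotone,
  -- so a shorter arc turns by no more.
  have hturn : normalAngle w w' l ≤ normalAngle w w' 0 + j * Real.pi := by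
    rcases hj with ⟨rfl, hl2⟩ | hj
    · have hp : ∀ θ ∈ Icc 0 (2 * Real.pi), 0 < w θ := fun θ _ => by
        have := ha θ
        simp only [hw]; linarith
      have hm := monotoneOn_normalAngle d1 d2 hp fun θ _ => by simp [hw, hw'']
      have := hm ⟨hl.le, hl2⟩ ⟨by positivity, le_rfl⟩ hl2
      refine this.trans_eq ?_
      simp [normalAngle, hw, hw']
      ring
    · simp only [normalAngle, hw, hw']
      simpa using hj
  have hdiv : ∀ θ, HasDerivAt (fun θ : ℝ => θ / l) (1 / l) θ := fun θ =>
    (hasDerivAt_id θ).div_const l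
  have hQ : ∀ (P : Polynomial ℝ) (θ : ℝ), HasDerivAt (fun θ => P.eval (θ / l))
      (P.derivative.eval (θ / l) / l) θ := fun P θ => by
    have := (P.hasDerivAt (θ / l)).comp θ (hdiv θ)
    rwa [mul_one_div] at this
  have D1 : ∀ θ, HasDerivAt (fun θ => w θ + ε * Q.eval (θ / l))
      (w' θ + ε * (Q.derivative.eval (θ / l) / l)) θ := fun θ =>
    (d1 θ).add ((hQ Q θ).const_mul ε)
  have D2 : ∀ θ, HasDerivAt (fun θ => w' θ + ε * (Q.derivative.eval (θ / l) / l))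
      (w'' θ + ε * (Q.derivative.derivative.eval (θ / l) / l / l)) θ := fun θ =>
    (d2 θ).add (((hQ Q.derivative θ).div_const l).const_mul ε)
  have hIcc : ∀ θ ∈ Icc 0 l, θ / l ∈ Icc (0 : ℝ) 1 := fun θ hθ =>
    ⟨div_nonneg hθ.1 hl.le, (div_le_one hl).2 hθ.2⟩
  refine piecewiseMonotone_of_convex_arc hl.le D1 D2 (fun θ hθ => ?_) (fun θ hθ => ?_) j ?_ A B
  · have := hε _ (hIcc θ hθ)
    have := ha θ
    simp only [hw]; linarith
  -- The unperturbed ellipse has `w + w'' = 1`, which leaves room for a small perturbation.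
  · have h5 := hε' _ (hIcc θ hθ)
    have h6 : w θ + ε * Q.eval (θ / l) +
        (w'' θ + ε * (Q.derivative.derivative.eval (θ / l) / l / l)) =
        1 + ε * (Q.eval (θ / l) + Q.derivative.derivative.eval (θ / l) / l ^ 2) := by
      simp only [hw, hw'']
      field_simp
      ring
    rw [h6]
    linarith
  -- The perturbation is flat at the ends, so the normal angles there, and hence the total turning,
  -- are those of the ellipse.
  · simpa [normalAngle, h0, h1, h2, h3, div_self hl.ne'] using hturn

/-- At the parabolic limit `e = 1` the quotient is `tan (x / 2)`, and `x / 2 > x - π / 2`; by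
continuity some `e < 1` also works. With `x` half the length of an arc centred at the point nearest
the focus, the turning is `2x` minus twice this arctangent, so at most `π`. -/
theorem exists_eccentricity {x : ℝ} (h0 : 0 < x) (hπ : x < Real.pi) :
    ∃ e, 0 ≤ e ∧ e < 1 ∧
      x - Real.pi / 2 ≤ Real.arctan (e * Real.sin x / (1 + e * Real.cos x)) := by
  have hcos : 0 < Real.cos (x / 2) := Real.cos_pos_of_mem_Ioo ⟨by linarith, by linarith⟩
  have e1 : Real.cos x = 2 * Real.cos (x / 2) ^ 2 - 1 := by
    rw [← Real.cos_two_mul]; ring_nf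
  have e2 : Real.sin x = 2 * Real.sin (x / 2) * Real.cos (x / 2) := by
    rw [← Real.sin_two_mul]; ring_nf
  have hden : 1 + 1 * Real.cos x ≠ 0 := by
    rw [e1]; have := pow_pos hcos 2; linarith
  have hlim : ContinuousAt
      (fun e : ℝ => Real.arctan (e * Real.sin x / (1 + e * Real.cos x))) 1 := by
    refine Real.continuous_arctan.continuousAt.comp (ContinuousAt.div ?_ ?_ hden) <;> fun_prop
  have hval : x - Real.pi / 2 < Real.arctan (1 * Real.sin x / (1 + 1 * Real.cos x)) := by
    have : 1 * Real.sin x / (1 + 1 * Real.cos x) = Real.tan (x / 2) := by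
      rw [Real.tan_eq_sin_div_cos, e1, e2]
      field_simp
      ring
    rw [this, Real.arctan_tan (by linarith) (by linarith)]
    linarith
  have h1 := (hlim.eventually (lt_mem_nhds hval)).filter_mono
    (nhdsWithin_le_nhds (s := Iio (1 : ℝ)))
  have h2 : ∀ᶠ e : ℝ in nhdsWithin 1 (Iio 1), 0 ≤ e ∧ e < 1 := by
    filter_upwards [Ico_mem_nhdsLT (zero_lt_one' ℝ)] with e he using he
  obtain ⟨e, h3, h4⟩ := (h1.and h2).exists
  exact ⟨e, h4.1, h4.2, h3.le⟩

/-! ### The elliptical conformation of a spherical stick diagram -/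

namespace StickCurve

variable {n : ℕ} (γ : StickCurve n)

/-- The inverse radius of the conformation: an ellipsoid with focus at the origin, axis `u` and
eccentricity `e`, perturbed by `ε` times a piecewise polynomial function. -/
noncomputable def invRadius (u : E3) (e ε : ℝ) (Q : ZMod n → Polynomial ℝ) (s : ℝ) : ℝ :=
  1 - e * inner ℝ u (γ.curve s) + ε * glue (fun i t => (Q i).eval t) s

theorem inner_arc_le {u : E3} (hu : ‖u‖ = 1) {e : ℝ} (he : 0 ≤ e) (i : ZMod n) (θ : ℝ) :
    e * inner ℝ u (γ.base i) * Real.cos θ + e * inner ℝ u (γ.dir i) * Real.sin θ ≤ e := by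
  have h1 := real_inner_le_norm u (Real.cos θ • γ.base i + Real.sin θ • γ.dir i)
  rw [γ.norm_cos_add_sin, hu, inner_add_right, inner_smul_right, inner_smul_right] at h1
  have := mul_le_mul_of_nonneg_left h1 he
  linarith

theorem piecewiseMonotone_arc {u : E3} (hu : ‖u‖ = 1) {e ε : ℝ} (he : 0 ≤ e) (he1 : e < 1)
    {Q : ZMod n → Polynomial ℝ} (hQ : ∀ i, (Q i).eval 0 = 0 ∧ (Q i).eval 1 = 0 ∧
      (Q i).derivative.eval 0 = 0 ∧ (Q i).derivative.eval 1 = 0)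
    (hε : ∀ i, ∀ t ∈ Icc (0 : ℝ) 1, -(1 - e) < ε * (Q i).eval t)
    (hε' : ∀ i, ∀ t ∈ Icc (0 : ℝ) 1,
      -1 ≤ ε * ((Q i).eval t + (Q i).derivative.derivative.eval t / γ.len i ^ 2))
    (p : E3) (k : ℤ) (j : ℕ)
    (hj : j = 2 ∨ γ.len k + Real.arctan
        ((e * inner ℝ u (γ.base k) * Real.sin (γ.len k) -
          e * inner ℝ u (γ.dir k) * Real.cos (γ.len k)) /
        (1 - (e * inner ℝ u (γ.base k) * Real.cos (γ.len k) +
          e * inner ℝ u (γ.dir k) * Real.sin (γ.len k)))) ≤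
      Real.arctan (-(e * inner ℝ u (γ.dir k)) / (1 - e * inner ℝ u (γ.base k))) + j * Real.pi) :
    PiecewiseMonotone (fun s => inner ℝ p ((γ.invRadius u e ε Q s)⁻¹ • γ.curve s)) k (k + 1)
      (j + 1) := by
  have hl := γ.len_pos k
  have H := (piecewiseMonotone_of_perturbed_ellipse hl (hQ k).1 (hQ k).2.1 (hQ k).2.2.1
    (hQ k).2.2.2 (γ.inner_arc_le hu he k) he1 (hε k) (hε' k) j
    (hj.imp_left fun h => ⟨h, γ.len_le k⟩) (inner ℝ p (γ.base k))
    (inner ℝ p (γ.dir k))).comp_affine hl (k : ℝ)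
  rw [zero_div, add_zero, div_self hl.ne'] at H
  refine H.congr fun s hs => ?_
  have hQ' : ∀ i, (Q i).eval (1 : ℝ) = (Q (i + 1)).eval 0 := fun i => by
    rw [(hQ i).2.1, (hQ (i + 1)).1]
  have e1 : γ.curve s = γ.arc k (s - k) := glue_eqOn γ.arc_one k hs
  have e2 : glue (fun i t => (Q i).eval t) s = (Q k).eval (s - k) :=
    glue_eqOn (f := fun i t => (Q i).eval t) hQ' k hs
  simp only [invRadius, e1, e2, arc, inner_smul_right, inner_add_right]
  rw [mul_div_assoc, div_self hl.ne', mul_one]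
  generalize (Q k).eval (s - k) = q
  rw [div_eq_inv_mul]
  congr 1
  · congr 1
    ring
  · ring

end StickCurve

theorem exists_small_factor {n : ℕ} [NeZero n] (f : ZMod n → ℝ → ℝ) (hf : ∀ i, Continuous (f i))
    {η : ℝ} (hη : 0 < η) :
    ∃ ε₀ > 0, ∀ ε, 0 < ε → ε ≤ ε₀ → ∀ i, ∀ t ∈ Icc (0 : ℝ) 1, -η < ε * f i t := by
  have hb : ∀ i, ∃ C, ∀ t ∈ Icc (0 : ℝ) 1, ‖f i t‖ ≤ C := fun i =>
    isCompact_Icc.exists_bound_of_continuousOn (hf i).continuousOn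
  choose C hC using hb
  obtain ⟨D, hD⟩ := (Set.finite_range C).bddAbove
  have hD0 : 0 < max D 1 := lt_max_of_lt_right one_pos
  refine ⟨η / (2 * max D 1), by positivity, fun ε h0 hle i t ht => ?_⟩
  have h1 : -max D 1 ≤ f i t := by
    have := (abs_le.1 ((hC i t ht).trans ((hD (mem_range_self i)).trans (le_max_left D 1)))).1
    exact this
  have h2 : ε * (2 * max D 1) ≤ η := (le_div_iff₀ (by positivity)).1 hle
  have h3 := mul_le_mul_of_nonneg_left h1 h0.le
  linarith

/-- A knot type represented by a spherical stick diagram with `n` arcs has superbridge index at most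
`(3 * n - 1) / 2`. -/
theorem superbridgeIndex_le_of_represents {n : ℕ} (D : StickDiagram n) {κ : KnotType}
    (hD : D.Represents κ) : superbridgeIndex κ ≤ ((3 * n - 1) / 2 : ℕ) := by
  obtain ⟨r, hr, hrper, hrpos, hover, K, hK, hcarrier⟩ := hD
  set γ := D.toStickCurve
  have hn : 0 < n := γ.n_pos
  have : NeZero n := ⟨hn.ne'⟩
  have hnR : (0 : ℝ) < n := by exact_mod_cast hn
  obtain ⟨u, hu, e, he, he1, hspecial⟩ : ∃ u : E3, ‖u‖ = 1 ∧ ∃ e : ℝ, 0 ≤ e ∧ e < 1 ∧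
      (2 ≤ n → γ.len 0 + Real.arctan
        ((e * inner ℝ u (γ.base 0) * Real.sin (γ.len 0) -
          e * inner ℝ u (γ.dir 0) * Real.cos (γ.len 0)) /
        (1 - (e * inner ℝ u (γ.base 0) * Real.cos (γ.len 0) +
          e * inner ℝ u (γ.dir 0) * Real.sin (γ.len 0)))) ≤
      Real.arctan (-(e * inner ℝ u (γ.dir 0)) / (1 - e * inner ℝ u (γ.base 0))) + Real.pi) := by
    by_cases hn2 : 2 ≤ n
    swap
    · exact ⟨γ.base 0, γ.norm_base 0, 0, le_rfl, one_pos, fun h => absurd h hn2⟩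
    -- A full circle followed by another arc would return to its starting corner, a
    -- self-intersection that is not interior to arcs.
    have hlen : γ.len 0 < 2 * Real.pi := by
      refine lt_of_le_of_ne (γ.len_le 0) fun h => ?_
      have h1 := γ.closed 0
      rw [h, Real.cos_two_pi, Real.sin_two_pi, one_smul, zero_smul, add_zero, zero_add] at h1
      have h2 : γ.curve 0 = γ.base 0 := by simp [StickCurve.curve, StickCurve.arc]
      have h3 : γ.curve 1 = γ.base 1 := by simp [StickCurve.curve, StickCurve.arc]
      refine D.crossing_interior 0 1 ⟨⟨le_rfl, hnR⟩, ⟨zero_le_one, ?_⟩, zero_ne_one, ?_⟩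
        Int.fract_zero
      · exact_mod_cast hn2
      · exact (h2.trans h1).trans h3.symm
    obtain ⟨e, he, he1, hx⟩ := exists_eccentricity (half_pos (γ.len_pos 0)) (by linarith)
    set x := γ.len 0 / 2 with hxdef
    have hl : γ.len 0 = 2 * x := by rw [hxdef]; ring
    have i3 : inner ℝ (γ.base 0) (γ.dir 0) = (0 : ℝ) := γ.orthogonal 0
    have i4 : inner ℝ (γ.dir 0) (γ.base 0) = (0 : ℝ) := by rw [real_inner_comm]; exact i3
    -- `u` is opposite to the midpoint of arc 0, which therefore gets the smallest radius of the
    -- ellipsoid.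
    refine ⟨-(Real.cos x • γ.base 0 + Real.sin x • γ.dir 0), by
      rw [norm_neg]; exact γ.norm_cos_add_sin 0 x, e, he, he1, fun _ => ?_⟩
    have j1 : inner ℝ (-(Real.cos x • γ.base 0 + Real.sin x • γ.dir 0)) (γ.base 0) =
        -Real.cos x := by
      simp [inner_add_left, inner_smul_left, γ.norm_base, i4]
    have j2 : inner ℝ (-(Real.cos x • γ.base 0 + Real.sin x • γ.dir 0)) (γ.dir 0) =
        -Real.sin x := by
      simp [inner_add_left, inner_smul_left, γ.norm_dir, i3]
    have s1 : Real.sin x = Real.sin (2 * x) * Real.cos x - Real.cos (2 * x) * Real.sin x := by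
      rw [← Real.sin_sub]; ring_nf
    have s2 : Real.cos x = Real.cos (2 * x) * Real.cos x + Real.sin (2 * x) * Real.sin x := by
      rw [← Real.cos_sub]; ring_nf
    rw [j1, j2, hl]
    have k1 : e * -Real.cos x * Real.sin (2 * x) - e * -Real.sin x * Real.cos (2 * x) =
        -(e * Real.sin x) := by linear_combination e * s1
    have k2 : 1 - (e * -Real.cos x * Real.cos (2 * x) + e * -Real.sin x * Real.sin (2 * x)) =
        1 + e * Real.cos x := by linear_combination -e * s2
    have k3 : -(e * -Real.sin x) / (1 - e * -Real.cos x) =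
        e * Real.sin x / (1 + e * Real.cos x) := by
      rw [mul_neg, neg_neg, mul_neg, sub_neg_eq_add]
    rw [k1, k2, k3, neg_div, Real.arctan_neg]
    linarith
  classical
  set S : Set ℝ := {x | ∃ y, γ.IsCrossing x y}
  have hSfin : S.Finite := by
    refine (D.finite_crossings.image Prod.fst).subset ?_
    rintro x ⟨y, hxy⟩
    exact ⟨(x, y), hxy, rfl⟩
  -- The two strands of a crossing have equal inverse radius before the perturbation; lowering it on
  -- the overstrand moves that strand outwards.
  obtain ⟨Q, hQ, hQv⟩ := exists_flat_polynomials S hSfin (fun x ⟨y, hxy⟩ => hxy.1)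
    (fun x ⟨y, hxy⟩ => D.crossing_interior x y hxy) fun x => if x ∈ D.upper then (-1 : ℝ) else 0
  obtain ⟨ε₁, hε₁, hsmall₁⟩ := exists_small_factor (fun i t => (Q i).eval t)
    (fun i => (Q i).continuous) (sub_pos.2 he1)
  obtain ⟨ε₂, hε₂, hsmall₂⟩ := exists_small_factor
    (fun i t => (Q i).eval t + (Q i).derivative.derivative.eval t / γ.len i ^ 2)
    (fun i => (Q i).continuous.add ((Q i).derivative.derivative.continuous.div_const _)) one_pos
  set ε := min ε₁ ε₂
  have hε : 0 < ε := lt_min hε₁ hε₂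
  have hsm₁ := hsmall₁ ε hε (min_le_left _ _)
  have hsm₂ := hsmall₂ ε hε (min_le_right _ _)
  set w := γ.invRadius u e ε Q with hw
  have hQglue : ∀ i, (Q i).eval (1 : ℝ) = (Q (i + 1)).eval 0 := fun i => by
    rw [(hQ i).2.1, (hQ (i + 1)).1]
  have hwc : Continuous w := by
    have h1 : Continuous (glue fun i t => (Q i).eval t) :=
      continuous_glue (fun i => (Q i).continuous) hQglue
    have h2 := γ.continuous_curve
    rw [hw]
    unfold StickCurve.invRadius
    fun_prop
  have hwper : Function.Periodic w n := fun s => by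
    simp only [hw, StickCurve.invRadius, γ.curve_periodic s,
      glue_periodic (fun i t => (Q i).eval t) s]
  have hwpos : ∀ s, 0 < w s := fun s => by
    have h1 := hsm₁ (⌊s⌋ : ZMod n) (Int.fract s) ⟨Int.fract_nonneg s, (Int.fract_lt_one s).le⟩
    have h2 := real_inner_le_norm u (γ.curve s)
    rw [hu, γ.norm_curve, one_mul] at h2
    have h3 := mul_le_mul_of_nonneg_left h2 he
    have h4 : w s = 1 - e * inner ℝ u (γ.curve s) +
      ε * (Q (⌊s⌋ : ZMod n)).eval (Int.fract s) := rfl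
    rw [h4]
    linarith
  have hwlt : ∀ x y, γ.IsCrossing x y → x ∈ D.upper → w x < w y := by
    intro x y hxy hx
    have hyx : γ.IsCrossing y x := ⟨hxy.2.1, hxy.1, hxy.2.2.1.symm, hxy.2.2.2.symm⟩
    have h1 := hQv x ⟨y, hxy⟩
    have h2 := hQv y ⟨x, hyx⟩
    rw [if_pos hx] at h1
    rw [if_neg ((D.upper_iff x y hxy).1 hx)] at h2
    simp only [hw, StickCurve.invRadius, h1, h2, hxy.2.2.2]
    linarith
  have hiso : AmbientIsotopic K.carrier (range fun s => (w s)⁻¹ • γ.curve s) := by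
    rw [hcarrier]
    refine ambientIsotopic_of_periodic_radii hnR γ.continuous_curve hr
      (hwc.inv₀ fun s => (hwpos s).ne') γ.curve_periodic hrper
      (fun s => congrArg _ (hwper s)) γ.norm_curve hrpos (fun s => inv_pos.2 (hwpos s)) ?_ ?_ ?_
    · refine hSfin.subset ?_
      rintro x ⟨hx, y, hy, hne, heq⟩
      exact ⟨y, hx, hy, hne.symm, heq.symm⟩
    · intro x hx y hy z hz h1 h2 h3 h4
      exact D.no_triple x y z ⟨hx, hy, h1.symm, h3.symm⟩ ⟨hx, hz, h2.symm, h4.symm⟩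
    · intro x hx y hy hne heq
      have hxy : γ.IsCrossing x y := ⟨hx, hy, hne, heq⟩
      by_cases hxu : x ∈ D.upper
      · have h1 := hover x y hxy hxu
        have h2 := inv_strictAnti₀ (hwpos x) (hwlt x y hxy hxu)
        exact mul_pos (by linarith) (by linarith)
      · have hyx : γ.IsCrossing y x := ⟨hy, hx, hne.symm, heq.symm⟩
        have hyu : y ∈ D.upper := (D.upper_iff y x hyx).2 hxu
        have h1 := hover y x hyx hyu
        have h2 := inv_strictAnti₀ (hwpos y) (hwlt y x hyx hyu)
        exact mul_pos_of_neg_of_neg (by linarith) (by linarith)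
  obtain ⟨K', hK', hcar'⟩ : ∃ K' : Knot, knotType K' = κ ∧
      K'.carrier = range fun s => (w s)⁻¹ • γ.curve s := by
    refine ⟨⟨range fun s => (w s)⁻¹ • γ.curve s, ?_, ?_⟩, ?_, rfl⟩
    · obtain ⟨f, hf, hinj, hrange⟩ := K.simple_closed
      obtain ⟨H, -, -, hH⟩ := hiso
      exact ⟨H 1 ∘ f, (H 1).continuous.comp hf, (H 1).injective.comp hinj, by
        rw [range_comp, hrange, hH]⟩
    · obtain ⟨P, hP, hKP⟩ := K.tame
      exact ⟨P, hP, hiso.symm.trans hKP⟩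
    · rw [← hK]
      exact Quotient.sound hiso.symm
  refine (iInf₂_le K' hK').trans (iSup₂_le fun p _ => ?_)
  rw [hcar']
  have harc : ∀ k : ℤ, PiecewiseMonotone (fun s => inner ℝ p ((w s)⁻¹ • γ.curve s)) k (k + 1) 3 :=
    fun k => γ.piecewiseMonotone_arc hu he he1 hQ hsm₁ (fun i t ht => (hsm₂ i t ht).le) p k 2
      (.inl rfl)
  have hsum : ∀ {M : ℕ}, PiecewiseMonotone (fun s => inner ℝ p ((w s)⁻¹ • γ.curve s)) 0 1 M →
      ∀ m : ℕ, PiecewiseMonotone (fun s => inner ℝ p ((w s)⁻¹ • γ.curve s)) 0 ((m + 1 : ℕ) : ℝ)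
        (M + 3 * m) := by
    intro M H m
    induction m with
    | zero => simpa using H
    | succ m ih =>
      have := harc (m + 1 : ℕ)
      have h2 := ih.trans (by simpa only [Int.cast_natCast] using this)
      push_cast at h2 ⊢
      exact h2
  have hXc : Continuous fun s => (w s)⁻¹ • γ.curve s :=
    (hwc.inv₀ fun s => (hwpos s).ne').smul γ.continuous_curve
  have hXper : Function.Periodic (fun s => (w s)⁻¹ • γ.curve s) n := fun s => by
    simp only [hwper s, γ.curve_periodic s]
  obtain ⟨m, rfl⟩ : ∃ m, n = m + 1 := ⟨n - 1, by omega⟩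
  -- A single arc has 3 pieces, and `3 / 2 = 1` in `ℕ`; otherwise the count is `2 + 3 * m = 3 * n -
  -- 1`.
  rcases Nat.eq_zero_or_pos m with rfl | hm
  · have H := hsum (by simpa using harc 0) 0
    exact br_le_of_piecewiseMonotone hnR hXc hXper p H (by norm_num) (by norm_num)
  · have h2 : PiecewiseMonotone (fun s => inner ℝ p ((w s)⁻¹ • γ.curve s)) 0 1 2 := by
      have := γ.piecewiseMonotone_arc hu he he1 hQ hsm₁ (fun i t ht => (hsm₂ i t ht).le) p 0 1
        (.inr (by simpa using hspecial (by omega)))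
      simpa using this
    refine br_le_of_piecewiseMonotone hnR hXc hXper p (hsum h2 m) ?_ ?_ <;> omega

end SphericalStick

/-! ### From the bound on the superbridge index to the inequality -/

theorem mainTheorem9 (κ : SphericalStick.KnotType) :
    (2 / 3 : ℝ≥0∞) * (SphericalStick.superbridgeIndex κ : ℝ≥0∞) + 1 / 3
      ≤ (SphericalStick.sphericalStickIndex κ : ℝ≥0∞) := by
  rcases eq_or_ne (SphericalStick.sphericalStickIndex κ) ⊤ with htop | htop
  · simp [htop]
  obtain ⟨k, hk⟩ := ENat.ne_top_iff_exists.1 htop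
  have hlt : SphericalStick.sphericalStickIndex κ < (k + 1 : ℕ) := by
    rw [← hk]
    exact_mod_cast Nat.lt_succ_self k
  unfold SphericalStick.sphericalStickIndex at hlt
  simp only [iInf_lt_iff] at hlt
  obtain ⟨n, D, hD, hn⟩ := hlt
  have hnk : n ≤ k := Nat.lt_succ_iff.1 (by exact_mod_cast hn)
  have hn0 : 0 < n := D.n_pos
  have h1 : (SphericalStick.superbridgeIndex κ : ℝ≥0∞) ≤ (((3 * n - 1) / 2 : ℕ) : ℝ≥0∞) := by
    have := SphericalStick.superbridgeIndex_le_of_represents D hD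
    exact_mod_cast ENat.toENNReal_le.2 this
  rw [← hk]
  generalize hB : (3 * n - 1) / 2 = B at h1
  -- As `n ≥ 1`, the subtraction in `3 * n - 1` is not truncated; rounding down the half then gives
  -- `2 * B + 1 ≤ 3 * n`.
  have h2 : 2 * B + 1 ≤ 3 * k := by omega
  have h3 : (2 / 3 : ℝ) * B + 1 / 3 ≤ k := by
    have : (2 * B + 1 : ℝ) ≤ 3 * k := by exact_mod_cast h2
    linarith
  have e1 : (2 / 3 : ℝ≥0∞) = ENNReal.ofReal (2 / 3) := by
    rw [ENNReal.ofReal_div_of_pos (by norm_num)]; norm_num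
  have e2 : (1 / 3 : ℝ≥0∞) = ENNReal.ofReal (1 / 3) := by
    rw [ENNReal.ofReal_div_of_pos (by norm_num)]; norm_num
  calc (2 / 3 : ℝ≥0∞) * (SphericalStick.superbridgeIndex κ : ℝ≥0∞) + 1 / 3
      ≤ (2 / 3 : ℝ≥0∞) * (B : ℝ≥0∞) + 1 / 3 := by gcongr
    _ = ENNReal.ofReal ((2 / 3 : ℝ) * B + 1 / 3) := by
      rw [e1, e2, ← ENNReal.ofReal_natCast B, ← ENNReal.ofReal_mul (by norm_num),
        ← ENNReal.ofReal_add (by positivity) (by norm_num)]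
    _ ≤ ENNReal.ofReal k := ENNReal.ofReal_le_ofReal h3
    _ = _ := by rw [ENNReal.ofReal_natCast]; simp
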